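/- **Setting.** Let $\Gamma$ be a metric graph with finitely many internal edges $e$, identified with $[0,\ell_e]$, $\ell_e>0$ (loops and multiple edges allowed), and finitely many leads, identified with $[0,\infty)$. At every vertex $v$ let a unitary matrix $U_v$ be given, indexed by the edge ends meeting in $v$. The Hamiltonian $H$ acts as $-d^2/dx^2$ on the functions in $\bigoplus W^{2,2}(\text{edges})$ satisfying $(U_v-I)\Psi_v+i(U_v+I)\Psi_v'=0$ at all vertices, where $\Psi_v$, $\Psi_v'$ are the vectors of boundary values and of outgoing derivatives. An *embedded eigenvalue* is an eigenvalue $\lambda>0$ of $H$ when there is at least one lead (so that the continuous spectrum is $[0,\infty)$). A number $k\in\mathbb C$ is a *resonance* if there is $f\not\equiv0$ with $-f''=k^2f$ on all edges that satisfies the coupling conditions and is of the form $c_je^{ikx}$ on every lead. Writing $U_v=\begin{pmatrix}U_1&U_2\\U_3&U_4\end{pmatrix}$ with respect to internal edge ends and leads, put $\tilde U_v(k)=U_1-(1-k)U_2[(1-k)U_4-(k+1)I]^{-1}U_3$ and let $\tilde\sigma_v(k)=-[(1-k)\tilde U_v(k)-(1+k)I]^{-1}[(1+k)\tilde U_v(k)-(1-k)I]$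 be the effective vertex-scattering matrix. Replace each internal edge by two oppositely oriented bonds. For bonds $b,b'$ such that $b$ ends in the vertex $v$ where $b'$ starts, let $S_{b'b}(k)$ be the entry of $\tilde\sigma_v(k)$ in the row of the initial end of $b'$ and the column of the final end of $b$; put $S_{b'b}=0$ otherwise. A periodic orbit is a nonempty closed path of bonds $\gamma=(b_1,\dots,b_n)$ up to cyclic permutation, with $A_\gamma=S_{b_2b_1}S_{b_3b_2}\cdots S_{b_1b_n}$ and $\ell_\gamma=\sum_j\ell_{b_j}$. An irreducible pseudo-orbit $\bar\gamma$ is a finite (possibly empty) collection of $m_{\bar\gamma}$ periodic orbits in which no bond occurs more than once; $A_{\bar\gamma}$ is the product of the $A_\gamma$ and $\ell_{\bar\gamma}$ the sum of the $\ell_\gamma$ over its members. The resonance condition is $$F(k)=\sum_{\bar\gamma}(-1)^{m_{\bar\gamma}}A_{\bar\gamma}(k)\,e^{ik\ell_{\bar\gamma}}=0 .$$ **Theorem.** Let the lengths of the internal edges $\ell_e=\ell_e(t)$ be $C^2$ functions of a real parameter $t$ near $t=0$, with $\ell_e(0)>0$, the couplings being fixed, and write $F(k,t)$ for the left-hand side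 of the resonance condition. Let $k_0>0$ be such that $k_0^2$ is an embedded eigenvalue of the graph at $t=0$. (a) Suppose that the eigenvalue $k_0^2$ is simple. Then there are $\delta,\varepsilon>0$ such that for $|t|<\delta$ all $\ell_e(t)>0$ and the equation $F(k,t)=0$ has exactly one solution $k=k(t)$ with $|k-k_0|<\varepsilon$. One has $k(0)=k_0$, and $k$ is $C^2$ on $(-\delta,\delta)$. For every such $t$ either $k(t)>0$ and $k(t)^2$ is an embedded eigenvalue, or $\operatorname{Im}k(t)<0$ and $k(t)$ is a resonance. Moreover: (i) $\dot k(0)\in\mathbb R$. (ii) For all $|t|<\delta$ the amplitudes $A_{\bar\gamma}$ are analytic at $k=k(t)$ and, with $k=k(t)$, $\ell_{\bar\gamma}=\ell_{\bar\gamma}(t)$, $$\dot k\sum_{\bar\gamma}\Big(\ell_{\bar\gamma}A_{\bar\gamma}-i\frac{\partial A_{\bar\gamma}}{\partial k}\Big)(-1)^{m_{\bar\gamma}}e^{ik\ell_{\bar\gamma}}+k\sum_{\bar\gamma}\dot\ell_{\bar\gamma}(-1)^{m_{\bar\gamma}}A_{\bar\gamma}e^{ik\ell_{\bar\gamma}}=0,$$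 $$\begin{aligned}&\ddot k\sum_{\bar\gamma}\Big(\ell_{\bar\gamma}A_{\bar\gamma}-i\frac{\partial A_{\bar\gamma}}{\partial k}\Big)(-1)^{m_{\bar\gamma}}e^{ik\ell_{\bar\gamma}}+2\dot k\sum_{\bar\gamma}\Big(ik\ell_{\bar\gamma}\dot\ell_{\bar\gamma}A_{\bar\gamma}+\dot\ell_{\bar\gamma}A_{\bar\gamma}+k\dot\ell_{\bar\gamma}\frac{\partial A_{\bar\gamma}}{\partial k}\Big)(-1)^{m_{\bar\gamma}}e^{ik\ell_{\bar\gamma}}\\&+\dot k^2\sum_{\bar\gamma}\Big(2\ell_{\bar\gamma}\frac{\partial A_{\bar\gamma}}{\partial k}-i\frac{\partial^2A_{\bar\gamma}}{\partial k^2}+i\ell_{\bar\gamma}^2A_{\bar\gamma}\Big)(-1)^{m_{\bar\gamma}}e^{ik\ell_{\bar\gamma}}+k\sum_{\bar\gamma}\big(\ddot\ell_{\bar\gamma}+ik\dot\ell_{\bar\gamma}^2\big)A_{\bar\gamma}(-1)^{m_{\bar\gamma}}e^{ik\ell_{\bar\gamma}}=0.\end{aligned}$$ The common coefficient $\sum_{\bar\gamma}(\ell_{\bar\gamma}A_{\bar\gamma}-i\,\partial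 A_{\bar\gamma}/\partial k)(-1)^{m_{\bar\gamma}}e^{ik\ell_{\bar\gamma}}$ of $\dot k$ and $\ddot k$ is nonzero, so these equations determine $\dot k$ and $\ddot k$, and $k(t)=k_0+\dot k(0)t+\tfrac12\ddot k(0)t^2+o(t^2)$ as $t\to0$. (b) Without assuming simplicity, there are $\delta,\varepsilon>0$ such that every solution $k$ of $F(k,t)=0$ with $|t|<\delta$, $|k-k_0|<\varepsilon$ either is positive with $k^2$ an embedded eigenvalue, or has $\operatorname{Im}k<0$ and is a resonance. Along every function $k(t)$, $C^2$ near $t=0$, with $k(0)=k_0$ and $F(k(t),t)=0$ for small $t$, one has $\dot k(0)\in\mathbb R$, and for all small $t$ the amplitudes are analytic at $k(t)$ and the two equations in (ii) hold. -/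

import Mathlib

open Set Filter Topology MeasureTheory

/-- The combinatorial part of a quantum graph together with its vertex couplings.
`V` are the vertices, `E` the internal edges, `X` the external edges (leads).
An element `p : E × Bool` is an end of an internal edge: `(e, false)` is the end `x = 0` and
`(e, true)` is the end `x = ℓ_e`; `vert p` is the vertex sitting at that end.
Every lead `x : X` starts (at its point `0`) in the vertex `leadVert x`.
The coupling at `v` is a unitary matrix indexed by the edge ends that meet in `v`, the ends of
internal edges first and the leads second. Loops and multiple edges are allowed. -/
structure QuantumGraph (V E X : Type*) [Fintype E] [Fintype X]
    [DecidableEq V] [DecidableEq E] [DecidableEq X] where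
  vert : E × Bool → V
  leadVert : X → V
  U : ∀ v : V, Matrix ({p : E × Bool // vert p = v} ⊕ {x : X // leadVert x = v})
    ({p : E × Bool // vert p = v} ⊕ {x : X // leadVert x = v}) ℂ
  unitary : ∀ v : V, U v ∈ Matrix.unitaryGroup _ ℂ

/-- The coordinate domain of an edge: `[0, ℓ_e]` for internal edges, `[0, ∞)` for leads. -/
def edgeDomain {E X : Type*} (ℓ : E → ℝ) : E ⊕ X → Set ℝ :=
  Sum.elim (fun e => Set.Icc 0 (ℓ e)) (fun _ => Set.Ici 0)

/-- `f ∈ W^{2,2}` of the interval `s` (which starts at `0`), with second derivative `h`: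
`f` is the everywhere differentiable representative, its derivative is absolutely continuous with
density `h`, and `f, f', h` are square integrable on `s`. -/
structure HasSecondSobolevDeriv (s : Set ℝ) (f h : ℝ → ℂ) : Prop where
  memLp : MemLp f 2 (volume.restrict s)
  memLp_deriv : MemLp (derivWithin f s) 2 (volume.restrict s)
  memLp_second : MemLp h 2 (volume.restrict s)
  differentiableOn : DifferentiableOn ℝ f s
  deriv_eq : ∀ x ∈ s, derivWithin f s x = derivWithin f s 0 + ∫ y in (0 : ℝ)..x, h y

/-- The matrix `Ũ(k) = U₁ - (1-k) U₂ [(1-k) U₄ - (k+1) I]⁻¹ U₃` of the effective coupling that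
replaces the leads (index set `m`) at a vertex with coupling matrix `U`. -/
noncomputable def effectiveCoupling {n m : Type*} [Fintype n] [Fintype m]
    [DecidableEq n] [DecidableEq m] (U : Matrix (n ⊕ m) (n ⊕ m) ℂ) (k : ℂ) : Matrix n n ℂ :=
  U.toBlocks₁₁ - (1 - k) • (U.toBlocks₁₂ *
    ((1 - k) • U.toBlocks₂₂ - (k + 1) • (1 : Matrix m m ℂ))⁻¹ * U.toBlocks₂₁)

/-- The effective vertex-scattering matrix
`σ̃(k) = -[(1-k) Ũ(k) - (1+k) I]⁻¹ [(1+k) Ũ(k) - (1-k) I]`. -/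
noncomputable def effectiveScattering {n m : Type*} [Fintype n] [Fintype m]
    [DecidableEq n] [DecidableEq m] (U : Matrix (n ⊕ m) (n ⊕ m) ℂ) (k : ℂ) : Matrix n n ℂ :=
  -(((1 - k) • effectiveCoupling U k - (1 + k) • (1 : Matrix n n ℂ))⁻¹ *
    ((1 + k) • effectiveCoupling U k - (1 - k) • (1 : Matrix n n ℂ)))

/-- For `Re k > 0` and a contraction `A`, the matrix `(1-k) A - (1+k) I` is invertible. -/
theorem isUnit_det_of_contraction {m : Type*} [Fintype m] [DecidableEq m] (A : Matrix m m ℂ)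
    (hA : ∀ x : m → ℂ, ∑ i, ‖(A.mulVec x) i‖ ^ 2 ≤ ∑ i, ‖x i‖ ^ 2) {k : ℂ} (hk : 0 < k.re) :
    IsUnit ((1 - k) • A - (1 + k) • (1 : Matrix m m ℂ)).det := by
  rw [isUnit_iff_ne_zero]
  intro h0
  obtain ⟨x, hx, h⟩ := Matrix.exists_mulVec_eq_zero_iff.mpr h0
  have h1 : ∀ i, (1 - k) * (A.mulVec x) i = (1 + k) * x i := by
    intro i
    have := congrFun h i
    simp only [Matrix.sub_mulVec, Matrix.smul_mulVec, Matrix.one_mulVec, Pi.sub_apply,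
      Pi.smul_apply, smul_eq_mul, Pi.zero_apply] at this
    exact sub_eq_zero.mp this
  have h2 : ‖1 + k‖ ^ 2 * ∑ i, ‖x i‖ ^ 2 = ‖1 - k‖ ^ 2 * ∑ i, ‖(A.mulVec x) i‖ ^ 2 := by
    rw [Finset.mul_sum, Finset.mul_sum]
    refine Finset.sum_congr rfl fun i _ => ?_
    rw [← mul_pow, ← mul_pow, ← norm_mul, ← norm_mul, h1]
  have h3 : ‖1 - k‖ ^ 2 < ‖1 + k‖ ^ 2 := by
    rw [← Complex.normSq_eq_norm_sq, ← Complex.normSq_eq_norm_sq, Complex.normSq_apply,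
      Complex.normSq_apply]
    simp
    nlinarith
  have h4 : 0 < ∑ i, ‖x i‖ ^ 2 := by
    obtain ⟨i, hi⟩ := Function.ne_iff.mp hx
    exact Finset.sum_pos' (fun _ _ => by positivity) ⟨i, Finset.mem_univ _, by
      have : 0 < ‖x i‖ := norm_pos_iff.mpr hi
      positivity⟩
  have h5 := hA x
  have h6 : 0 ≤ ‖1 - k‖ ^ 2 := by positivity
  nlinarith

theorem sum_norm_sq_unitary {n : Type*} [Fintype n] [DecidableEq n] {U : Matrix n n ℂ}
    (hU : U ∈ Matrix.unitaryGroup n ℂ) (x : n → ℂ) :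
    ∑ i, ‖(U.mulVec x) i‖ ^ 2 = ∑ i, ‖x i‖ ^ 2 := by
  have key : ∀ y : n → ℂ, ((∑ i, ‖y i‖ ^ 2 : ℝ) : ℂ) = star y ⬝ᵥ y := by
    intro y
    simp [dotProduct, Complex.conj_mul']
  have : star (U.mulVec x) ⬝ᵥ (U.mulVec x) = star x ⬝ᵥ x := by
    rw [Matrix.star_mulVec, Matrix.dotProduct_mulVec, Matrix.vecMul_vecMul,
      ← Matrix.star_eq_conjTranspose, Matrix.mem_unitaryGroup_iff'.mp hU, Matrix.vecMul_one]
  rw [← key, ← key] at this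
  exact_mod_cast this

theorem sum_norm_sq_block_le {n m : Type*} [Fintype n] [Fintype m]
    [DecidableEq n] [DecidableEq m] {U : Matrix (n ⊕ m) (n ⊕ m) ℂ}
    (hU : U ∈ Matrix.unitaryGroup _ ℂ) (x : m → ℂ) :
    ∑ i, ‖(U.toBlocks₂₂.mulVec x) i‖ ^ 2 ≤ ∑ i, ‖x i‖ ^ 2 := by
  have h := sum_norm_sq_unitary hU (Sum.elim 0 x)
  rw [← Matrix.fromBlocks_toBlocks U, Matrix.fromBlocks_mulVec] at h
  simp at h
  rw [← h]
  exact le_add_of_nonneg_left (Finset.sum_nonneg fun _ _ => by positivity)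

/-- `effectiveScattering U k` is the matrix that maps the incoming to the outgoing amplitudes at a
vertex: for wave functions `a^in e^{-ikx} + a^out e^{ikx}` on the internal edges and `b e^{ikx}` on
the leads, the coupling condition can be satisfied by some `b` iff `a^out = σ̃(k) a^in`. -/
theorem effectiveScattering_spec {n m : Type*} [Fintype n] [Fintype m]
    [DecidableEq n] [DecidableEq m] {U : Matrix (n ⊕ m) (n ⊕ m) ℂ}
    (hU : U ∈ Matrix.unitaryGroup _ ℂ) {k : ℂ} (hk : 0 < k.re) (ain aout : n → ℂ) :
    aout = (effectiveScattering U k).mulVec ain ↔ ∃ b : m → ℂ,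
      (U - 1).mulVec (Sum.elim (ain + aout) b) +
        Complex.I • (U + 1).mulVec
          (Sum.elim ((Complex.I * k) • (aout - ain)) ((Complex.I * k) • b)) = 0 := by
  have hI : Complex.I * Complex.I = -1 := Complex.I_mul_I
  have hD0 := isUnit_det_of_contraction _ (sum_norm_sq_block_le hU) hk
  have hF0 := isUnit_det_of_contraction U (fun x => (sum_norm_sq_unitary hU x).le) hk
  unfold effectiveScattering effectiveCoupling
  rw [add_comm k 1]
  set D := (1 - k) • U.toBlocks₂₂ - (1 + k) • (1 : Matrix m m ℂ) with hDdef
  set W := U.toBlocks₁₁ - (1 - k) • (U.toBlocks₁₂ * D⁻¹ * U.toBlocks₂₁) with hW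
  have hE0 : IsUnit ((1 - k) • W - (1 + k) • (1 : Matrix n n ℂ)).det := by
    have hB : (1 - k) • U - (1 + k) • (1 : Matrix (n ⊕ m) (n ⊕ m) ℂ)
        = Matrix.fromBlocks ((1 - k) • U.toBlocks₁₁ - (1 + k) • 1) ((1 - k) • U.toBlocks₁₂)
          ((1 - k) • U.toBlocks₂₁) D := by
      conv_lhs => rw [← Matrix.fromBlocks_toBlocks U, ← Matrix.fromBlocks_one]
      rw [Matrix.fromBlocks_smul, Matrix.fromBlocks_smul, sub_eq_add_neg, Matrix.fromBlocks_neg,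
        Matrix.fromBlocks_add]
      simp [hDdef, sub_eq_add_neg]
    rw [hB] at hF0
    have := Matrix.invertibleOfIsUnitDet D hD0
    rw [Matrix.det_fromBlocks₂₂, IsUnit.mul_iff] at hF0
    convert hF0.2 using 2
    rw [hW, Matrix.invOf_eq_nonsing_inv]
    simp only [smul_sub, Matrix.smul_mul, Matrix.mul_smul, smul_smul]
    abel
  set Em := (1 - k) • W - (1 + k) • (1 : Matrix n n ℂ) with hEm
  have hDi : D⁻¹ * D = 1 := Matrix.nonsing_inv_mul _ hD0
  have hDi' : D * D⁻¹ = 1 := Matrix.mul_nonsing_inv _ hD0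
  have hEi : Em⁻¹ * Em = 1 := Matrix.nonsing_inv_mul _ hE0
  have hEi' : Em * Em⁻¹ = 1 := Matrix.mul_nonsing_inv _ hE0
  have h1 : aout = (-(Em⁻¹ * ((1 + k) • W - (1 - k) • (1 : Matrix n n ℂ)))).mulVec ain ↔
      Em.mulVec aout + ((1 + k) • W - (1 - k) • (1 : Matrix n n ℂ)).mulVec ain = 0 := by
    constructor
    · intro h
      rw [h, Matrix.neg_mulVec, Matrix.mulVec_neg, Matrix.mulVec_mulVec, ← Matrix.mul_assoc, hEi',
        Matrix.one_mul, neg_add_cancel]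
    · intro h
      have h' := congrArg (fun z => Em⁻¹.mulVec z) (eq_neg_of_add_eq_zero_left h)
      simp only [Matrix.mulVec_mulVec, hEi, Matrix.one_mulVec, Matrix.mulVec_neg] at h'
      rw [Matrix.neg_mulVec]
      exact h'
  rw [h1]
  have h2 : ∀ b : m → ℂ, ((U - 1).mulVec (Sum.elim (ain + aout) b) +
        Complex.I • (U + 1).mulVec
          (Sum.elim ((Complex.I * k) • (aout - ain)) ((Complex.I * k) • b)) = 0 ↔
      U.toBlocks₁₁.mulVec ((1 - k) • aout + (1 + k) • ain) +
        U.toBlocks₁₂.mulVec ((1 - k) • b) = (1 + k) • aout + (1 - k) • ain ∧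
      U.toBlocks₂₁.mulVec ((1 - k) • aout + (1 + k) • ain) + D.mulVec b = 0) := by
    intro b
    have e1 : Sum.elim ((Complex.I * k) • (aout - ain)) ((Complex.I * k) • b)
      = (Complex.I * k) • Sum.elim (aout - ain) b := by
      ext (i | i) <;> simp
    rw [e1, Matrix.mulVec_smul, smul_smul]
    have e2 : Complex.I * (Complex.I * k) = -k := by rw [← mul_assoc, hI]; ring
    rw [e2]
    have e3 : (U - 1).mulVec (Sum.elim (ain + aout) b) + -k • (U + 1).mulVec (Sum.elim (aout - ain) b)
        = Sum.elim (U.toBlocks₁₁.mulVec ((1 - k) • aout + (1 + k) • ain) +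
        U.toBlocks₁₂.mulVec ((1 - k) • b) - ((1 + k) • aout + (1 - k) • ain))
        (U.toBlocks₂₁.mulVec ((1 - k) • aout + (1 + k) • ain) + D.mulVec b) := by
      rw [Matrix.sub_mulVec, Matrix.add_mulVec, Matrix.one_mulVec, Matrix.one_mulVec]
      conv_lhs => rw [← Matrix.fromBlocks_toBlocks U, Matrix.fromBlocks_mulVec,
        Matrix.fromBlocks_mulVec]
      ext (i | i)
      · simp [Matrix.mulVec_add, Matrix.mulVec_sub, Matrix.mulVec_smul]
        ring
      · simp [hDdef, Matrix.mulVec_add, Matrix.mulVec_sub, Matrix.mulVec_smul, Matrix.sub_mulVec,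
          Matrix.smul_mulVec]
        ring
    rw [e3]
    constructor
    · intro h
      refine ⟨?_, ?_⟩
      · rw [← sub_eq_zero]
        ext i
        exact congrFun h (Sum.inl i)
      · ext i
        exact congrFun h (Sum.inr i)
    · rintro ⟨h, h'⟩
      rw [h, h', sub_self]
      ext (i | i) <;> rfl
  simp only [h2]
  have h3 : Em.mulVec aout + ((1 + k) • W - (1 - k) • (1 : Matrix n n ℂ)).mulVec ain =
      W.mulVec ((1 - k) • aout + (1 + k) • ain) - ((1 + k) • aout + (1 - k) • ain) := by
    simp [hEm, Matrix.mulVec_add, Matrix.sub_mulVec, Matrix.smul_mulVec, Matrix.mulVec_smul]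
    abel
  rw [h3, sub_eq_zero]
  set z := (1 - k) • aout + (1 + k) • ain with hz
  have h4 : W.mulVec z = U.toBlocks₁₁.mulVec z
      + U.toBlocks₁₂.mulVec ((1 - k) • (-(D⁻¹.mulVec (U.toBlocks₂₁.mulVec z)))) := by
    rw [hW, Matrix.sub_mulVec, Matrix.smul_mulVec, Matrix.mulVec_smul, Matrix.mulVec_neg,
      Matrix.mulVec_mulVec, Matrix.mulVec_mulVec, Matrix.mul_assoc, smul_neg, sub_eq_add_neg]
  constructor
  · intro h
    refine ⟨-(D⁻¹.mulVec (U.toBlocks₂₁.mulVec z)), h4 ▸ h, ?_⟩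
    rw [Matrix.mulVec_neg, Matrix.mulVec_mulVec, hDi', Matrix.one_mulVec, add_neg_cancel]
  · rintro ⟨b, hb1, hb2⟩
    have hb : b = -(D⁻¹.mulVec (U.toBlocks₂₁.mulVec z)) := by
      have h' := congrArg (fun z => D⁻¹.mulVec z) (eq_neg_of_add_eq_zero_right hb2)
      simpa only [Matrix.mulVec_mulVec, hDi, Matrix.one_mulVec, Matrix.mulVec_neg] using h'
    rw [h4, ← hb, hb1]

namespace QuantumGraph

variable {V E X : Type*} [Fintype E] [Fintype X] [DecidableEq V] [DecidableEq E] [DecidableEq X]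

/-! ### The Hamiltonian, its eigenvalues, and resonances -/

/-- The vector of boundary values of `ψ` at the vertex `v`. -/
def boundaryValues (G : QuantumGraph V E X) (ℓ : E → ℝ) (ψ : E ⊕ X → ℝ → ℂ) (v : V) :
    {p : E × Bool // G.vert p = v} ⊕ {x : X // G.leadVert x = v} → ℂ :=
  Sum.elim (fun p => ψ (Sum.inl p.1.1) (if p.1.2 then ℓ p.1.1 else 0))
    (fun x => ψ (Sum.inr x.1) 0)

/-- The vector of derivatives of `ψ` at the vertex `v`, taken in the direction away from `v`. -/
noncomputable def boundaryDerivs (G : QuantumGraph V E X) (ℓ : E → ℝ) (ψ : E ⊕ X → ℝ → ℂ)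
    (v : V) : {p : E × Bool // G.vert p = v} ⊕ {x : X // G.leadVert x = v} → ℂ :=
  Sum.elim
    (fun p => if p.1.2 then -derivWithin (ψ (Sum.inl p.1.1)) (Set.Icc 0 (ℓ p.1.1)) (ℓ p.1.1)
      else derivWithin (ψ (Sum.inl p.1.1)) (Set.Icc 0 (ℓ p.1.1)) 0)
    (fun x => derivWithin (ψ (Sum.inr x.1)) (Set.Ici 0) 0)

/-- The coupling conditions `(U_v - I) Ψ_v + i (U_v + I) Ψ_v' = 0` at all vertices. -/
def Coupling (G : QuantumGraph V E X) (ℓ : E → ℝ) (ψ : E ⊕ X → ℝ → ℂ) : Prop :=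
  ∀ v, Matrix.mulVec (G.U v - 1) (G.boundaryValues ℓ ψ v)
    + Complex.I • Matrix.mulVec (G.U v + 1) (G.boundaryDerivs ℓ ψ v) = 0

/-- `ψ` is in the domain of the Hamiltonian `H` of the graph with edge lengths `ℓ`, and
`ψ'' = χ`, so that `H ψ = -χ`. -/
def InDomain (G : QuantumGraph V E X) (ℓ : E → ℝ) (ψ χ : E ⊕ X → ℝ → ℂ) : Prop :=
  (∀ e, HasSecondSobolevDeriv (edgeDomain ℓ e) (ψ e) (χ e)) ∧ G.Coupling ℓ ψ

/-- `ψ` does not vanish identically on the graph. -/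
def Nonzero (ℓ : E → ℝ) (ψ : E ⊕ X → ℝ → ℂ) : Prop :=
  ∃ e, ∃ x ∈ edgeDomain ℓ e, ψ e x ≠ 0

/-- `ψ` is an eigenfunction of `H` with eigenvalue `z`. -/
def IsEigenfunction (G : QuantumGraph V E X) (ℓ : E → ℝ) (z : ℂ) (ψ : E ⊕ X → ℝ → ℂ) : Prop :=
  ∃ χ, G.InDomain ℓ ψ χ ∧
    (∀ e, ∀ᵐ x ∂volume.restrict (edgeDomain ℓ e), -χ e x = z * ψ e x) ∧ Nonzero ℓ ψ

/-- `z` is an eigenvalue of `H`. -/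
def IsEigenvalue (G : QuantumGraph V E X) (ℓ : E → ℝ) (z : ℂ) : Prop :=
  ∃ ψ, G.IsEigenfunction ℓ z ψ

/-- The eigenvalue `lam` is embedded in the continuous spectrum: the graph has a lead, so that the
continuous spectrum is `[0, ∞)`, and `lam > 0`. -/
def IsEmbeddedEigenvalue (G : QuantumGraph V E X) (ℓ : E → ℝ) (lam : ℝ) : Prop :=
  Nonempty X ∧ 0 < lam ∧ G.IsEigenvalue ℓ (lam : ℂ)

/-- `z` is an eigenvalue whose eigenspace is at most one-dimensional: any eigenfunction is a
multiple (on the graph) of any other one. -/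
def IsSimpleAt (G : QuantumGraph V E X) (ℓ : E → ℝ) (z : ℂ) : Prop :=
  ∀ ψ φ, G.IsEigenfunction ℓ z ψ → G.IsEigenfunction ℓ z φ →
    ∃ c : ℂ, ∀ e, ∀ x ∈ edgeDomain ℓ e, φ e x = c * ψ e x

/-- There is a nontrivial generalized eigenfunction: `-ψ'' = k² ψ` on all edges, the coupling
conditions hold, and `ψ` is of the purely outgoing form `c_j e^{ikx}` on the leads (where the
differential equation is then automatic). -/
def IsResonance (G : QuantumGraph V E X) (ℓ : E → ℝ) (k : ℂ) : Prop :=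
  ∃ ψ : E ⊕ X → ℝ → ℂ,
    (∃ χ : E → ℝ → ℂ, ∀ e,
      HasSecondSobolevDeriv (Set.Icc 0 (ℓ e)) (ψ (Sum.inl e)) (χ e) ∧
      ∀ᵐ x ∂volume.restrict (Set.Icc 0 (ℓ e)), -χ e x = k ^ 2 * ψ (Sum.inl e) x) ∧
    (∀ j : X, ∃ c : ℂ, ∀ x ∈ Set.Ici (0 : ℝ),
      ψ (Sum.inr j) x = c * Complex.exp (Complex.I * k * x)) ∧
    G.Coupling ℓ ψ ∧ Nonzero ℓ ψ

/-! ### Bonds and the scattering matrix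

The bond `(e, false)` runs along `e` from `x = 0` to `x = ℓ_e`, and `(e, true)` runs backwards;
so a bond `b`, viewed as an edge end, is the end it starts from, and it arrives at the end
`rev b`. -/

/-- The bond with the opposite orientation. -/
def rev (b : E × Bool) : E × Bool := (b.1, !b.2)

/-- The matrix `Σ̃(k)`: in the basis of bonds it is built of the blocks `σ̃_v(k)`, the block of `v`
sitting on the bonds that are directed to `v`. -/
noncomputable def bigSigma (G : QuantumGraph V E X) (k : ℂ) : Matrix (E × Bool) (E × Bool) ℂ :=
  fun b' b => if h : G.vert (rev b') = G.vert (rev b) then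
    effectiveScattering (G.U (G.vert (rev b))) k ⟨rev b', h⟩ ⟨rev b, rfl⟩ else 0

/-- The matrix `Q`, which exchanges each bond with its reversal. -/
def bondSwap : Matrix (E × Bool) (E × Bool) ℂ := fun b' b => if b' = rev b then 1 else 0

/-- The scattering matrix `S(k) = Q Σ̃(k)`. -/
noncomputable def scattering (G : QuantumGraph V E X) (k : ℂ) :
    Matrix (E × Bool) (E × Bool) ℂ :=
  bondSwap * G.bigSigma k

/-! ### Pseudo-orbits -/

/-- A periodic orbit: a nonempty closed path of bonds, up to cyclic permutation, in which each bond
ends in the vertex where the next one starts. -/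
def IsPeriodicOrbit (G : QuantumGraph V E X) (γ : Cycle (E × Bool)) : Prop :=
  γ ≠ Cycle.nil ∧ γ.Chain (fun b b' => G.vert (rev b) = G.vert b')

/-- An irreducible pseudo-orbit: a collection of periodic orbits in which no bond occurs more than
once. The empty collection is allowed. -/
def IsIrreduciblePseudoOrbit (G : QuantumGraph V E X) (P : Multiset (Cycle (E × Bool))) : Prop :=
  (∀ γ ∈ P, G.IsPeriodicOrbit γ) ∧ (P.bind Cycle.toMultiset).Nodup

/-- The type of irreducible pseudo-orbits. -/
def PseudoOrbit (G : QuantumGraph V E X) : Type _ :=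
  {P : Multiset (Cycle (E × Bool)) // G.IsIrreduciblePseudoOrbit P}

theorem finite_pseudoOrbit (G : QuantumGraph V E X) : Finite G.PseudoOrbit := by
  classical
  have key : ∀ P, G.IsIrreduciblePseudoOrbit P → P.Nodup ∧ ∀ γ ∈ P, γ.Nodup := by
    intro P hP
    obtain ⟨hne, hnd⟩ := hP
    obtain ⟨h1, h2⟩ := Multiset.nodup_bind.mp hnd
    refine ⟨?_, fun γ hγ => ?_⟩
    · rw [Multiset.nodup_iff_pairwise]
      obtain ⟨l, rfl, hl⟩ := h2
      refine ⟨l, rfl, hl.imp_of_mem ?_⟩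
      rintro a b ha - hab rfl
      exact (hne a ha).1 (Cycle.toMultiset_eq_nil.mp (by simpa [Function.onFun] using hab))
    · have := h1 γ hγ
      induction γ using Quotient.inductionOn with
      | _ l => exact this
  refine Finite.of_injective
    (β := Finset {γ : Cycle (E × Bool) // γ.Nodup})
    (fun P => Finset.univ.filter (fun γ => γ.1 ∈ P.1)) ?_
  rintro ⟨P, hP⟩ ⟨P', hP'⟩ h
  obtain ⟨h1, h2⟩ := key P hP
  obtain ⟨h1', h2'⟩ := key P' hP'
  refine Subtype.ext ((Multiset.Nodup.ext h1 h1').mpr fun γ => ?_)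
  have h3 : ∀ γ : {γ : Cycle (E × Bool) // γ.Nodup}, γ.1 ∈ P ↔ γ.1 ∈ P' := fun γ => by
    simpa using congrArg (fun s => γ ∈ s) h
  exact ⟨fun hγ => (h3 ⟨γ, h2 γ hγ⟩).mp hγ, fun hγ => (h3 ⟨γ, h2' γ hγ⟩).mpr hγ⟩

noncomputable instance (G : QuantumGraph V E X) : Fintype G.PseudoOrbit :=
  @Fintype.ofFinite _ G.finite_pseudoOrbit

/-- The product `S_{b₂ b₁} S_{b₃ b₂} ⋯ S_{b₁ b_n}` along the cycle `(b₁, …, b_n)`. -/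
def cycleAmplitude {B : Type*} (S : Matrix B B ℂ) (γ : Cycle B) : ℂ :=
  Quotient.liftOn γ (fun l => (List.zipWith (fun b b' => S b' b) l (l.rotate 1)).prod) (by
    rintro a b h
    obtain ⟨n, rfl⟩ := h
    rw [List.rotate_rotate, add_comm, ← List.rotate_rotate,
      ← List.zipWith_rotate_distrib _ _ _ _ (by simp)]
    exact ((List.rotate_perm _ _).prod_eq).symm)

/-- The amplitude `A_γ̄(k)` of an irreducible pseudo-orbit. -/
noncomputable def PseudoOrbit.amplitude {G : QuantumGraph V E X} (P : G.PseudoOrbit) (k : ℂ) : ℂ :=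
  (P.1.map (cycleAmplitude (G.scattering k))).prod

/-- The metric length `ℓ_γ̄` of an irreducible pseudo-orbit for the edge lengths `ℓ`. -/
def PseudoOrbit.length {G : QuantumGraph V E X} (P : G.PseudoOrbit) (ℓ : E → ℝ) : ℝ :=
  (P.1.map (fun γ => (γ.toMultiset.map (fun b => ℓ b.1)).sum)).sum

/-- The sign `(-1)^{m_γ̄}`, with `m_γ̄` the number of periodic orbits in the pseudo-orbit. -/
def PseudoOrbit.sign {G : QuantumGraph V E X} (P : G.PseudoOrbit) : ℂ :=
  (-1) ^ Multiset.card P.1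

/-- The left-hand side of the resonance condition,
`F(k) = ∑_γ̄ (-1)^{m_γ̄} A_γ̄(k) e^{i k ℓ_γ̄}`, for the edge lengths `ℓ`. -/
noncomputable def resonanceFunction (G : QuantumGraph V E X) (ℓ : E → ℝ) (k : ℂ) : ℂ :=
  ∑ P : G.PseudoOrbit,
    P.sign * P.amplitude k * Complex.exp (Complex.I * k * (P.length ℓ : ℂ))

/-- The alternative for a solution `k` of the resonance condition: either `k` is real and positive
and `k²` is an embedded eigenvalue, or `k` lies in the open lower half-plane and is a resonance. -/
def EmbeddedEigenvalueOrResonance (G : QuantumGraph V E X) (ℓ : E → ℝ) (k : ℂ) : Prop :=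
  (∃ κ : ℝ, 0 < κ ∧ k = κ ∧ G.IsEmbeddedEigenvalue ℓ (κ ^ 2)) ∨ (k.im < 0 ∧ G.IsResonance ℓ k)

/-! ### The equations for the derivatives of a solution `k(t)` along edge lengths `ℓ(t)` -/

/-- The coefficient `∑_γ̄ (ℓ_γ̄ A_γ̄ - i ∂A_γ̄/∂k) (-1)^{m_γ̄} e^{i k ℓ_γ̄}` of the highest
derivative. -/
noncomputable def leadingCoefficient (G : QuantumGraph V E X) (ℓ : E → ℝ) (k : ℂ) : ℂ :=
  ∑ P : G.PseudoOrbit,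
    ((P.length ℓ : ℂ) * P.amplitude k - Complex.I * deriv P.amplitude k)
      * P.sign * Complex.exp (Complex.I * k * (P.length ℓ : ℂ))

/-- `d ℓ_γ̄ / dt`. -/
noncomputable def PseudoOrbit.lengthDot {G : QuantumGraph V E X} (P : G.PseudoOrbit)
    (ℓ : ℝ → E → ℝ) (t : ℝ) : ℝ :=
  deriv (fun s => P.length (ℓ s)) t

/-- `d² ℓ_γ̄ / dt²`. -/
noncomputable def PseudoOrbit.lengthDDot {G : QuantumGraph V E X} (P : G.PseudoOrbit)
    (ℓ : ℝ → E → ℝ) (t : ℝ) : ℝ :=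
  iteratedDeriv 2 (fun s => P.length (ℓ s)) t

/-- The equation for the first derivative of `k` at the time `t`. -/
def FirstOrderEquation (G : QuantumGraph V E X) (ℓ : ℝ → E → ℝ) (k : ℝ → ℂ) (t : ℝ) : Prop :=
  deriv k t * G.leadingCoefficient (ℓ t) (k t)
    + k t * ∑ P : G.PseudoOrbit,
      (P.lengthDot ℓ t : ℂ) * P.sign * P.amplitude (k t)
        * Complex.exp (Complex.I * k t * (P.length (ℓ t) : ℂ)) = 0

/-- The equation for the second derivative of `k` at the time `t`. -/
def SecondOrderEquation (G : QuantumGraph V E X) (ℓ : ℝ → E → ℝ) (k : ℝ → ℂ) (t : ℝ) : Prop :=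
  iteratedDeriv 2 k t * G.leadingCoefficient (ℓ t) (k t)
    + 2 * deriv k t * ∑ P : G.PseudoOrbit,
      (Complex.I * k t * (P.length (ℓ t) : ℂ) * (P.lengthDot ℓ t : ℂ) * P.amplitude (k t)
        + (P.lengthDot ℓ t : ℂ) * P.amplitude (k t)
        + k t * (P.lengthDot ℓ t : ℂ) * deriv P.amplitude (k t))
        * P.sign * Complex.exp (Complex.I * k t * (P.length (ℓ t) : ℂ))
    + deriv k t ^ 2 * ∑ P : G.PseudoOrbit,
      (2 * (P.length (ℓ t) : ℂ) * deriv P.amplitude (k t)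
        - Complex.I * iteratedDeriv 2 P.amplitude (k t)
        + Complex.I * (P.length (ℓ t) : ℂ) ^ 2 * P.amplitude (k t))
        * P.sign * Complex.exp (Complex.I * k t * (P.length (ℓ t) : ℂ))
    + k t * ∑ P : G.PseudoOrbit,
      ((P.lengthDDot ℓ t : ℂ) + Complex.I * k t * (P.lengthDot ℓ t : ℂ) ^ 2)
        * P.amplitude (k t) * P.sign
        * Complex.exp (Complex.I * k t * (P.length (ℓ t) : ℂ)) = 0

end QuantumGraph

/-! The resonance function is a secular determinant, F = det(I - S D), where D is the diagonal
matrix of the phases e^{ikℓ} of the bonds (`resonanceFunction_eq_det`). Expanding the Leibniz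
formula for det(I - M), each term is given by a set T of bonds and a permutation that fixes the
complement of T. The cycles of the permutation on T, with the fixed points in T counted as cycles of
length one, form an irreducible pseudo-orbit, and the signs combine to (-1)^m.

For Re k > 0, a zero of the determinant is a vector v ≠ 0 with S D v = v, that is, a wave that is
nontrivial on the internal edges and continues as a purely outgoing wave on the leads
(`scattering_mulVec_eq_iff`). Unitarity of the couplings means that no flux Im Σ ψ̄ψ' is lost at a
vertex (`AmplitudeCoupling.flux`). For real k > 0 this forces the lead amplitudes to vanish, so the
wave is an eigenfunction. For Im k > 0 it contradicts ∫|ψ|² > 0 on the internal edges, so there are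
no zeros at all. Consequently Im k(t) ≤ 0 along every branch of zeros through k₀, with equality at t
= 0, and the derivative of Im k vanishes at this maximum. The two equations in (ii) are the first
and second t-derivatives of F(k(t), t) = 0.

For a simple eigenvalue it remains to see that k₀ is a simple zero of F, since ∂F/∂k is i times the
leading coefficient. The quantitative form of the flux argument bounds (I - S D)⁻¹ by C/y at k₀ + iy
(`exists_resolvent_bound`). If the kernel at k₀ is one-dimensional and F(k₀ + iy) = o(y), there are
vectors x(y), bounded away from zero, that I - S D maps to o(y), contradicting the bound
(`deriv_det_ne_zero_of_resolvent_bound`). The implicit function theorem then yields the unique C²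
branch. -/

set_option linter.unusedSectionVars false

/-! ### Cycles of permutations and the expansion of det(I - M) -/

section Orbits

open Function

variable {B : Type*} [Fintype B] [DecidableEq B]

theorem Equiv.Perm.mem_periodicPts (σ : Equiv.Perm B) (b : B) : b ∈ periodicPts σ :=
  mk_mem_periodicPts (orderOf_pos σ) (by
    rw [IsPeriodicPt, IsFixedPt, ← Equiv.Perm.coe_pow, pow_orderOf_eq_one, Equiv.Perm.one_apply])

theorem periodicOrbit_eq_of_mem (σ : Equiv.Perm B) {b c : B} (h : c ∈ periodicOrbit σ b) :
    periodicOrbit σ c = periodicOrbit σ b := by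
  obtain ⟨n, rfl⟩ := (mem_periodicOrbit_iff (σ.mem_periodicPts b)).mp h
  exact periodicOrbit_apply_iterate_eq (σ.mem_periodicPts b) n

theorem mem_periodicOrbit_iff_sameCycle (σ : Equiv.Perm B) (b c : B) :
    c ∈ periodicOrbit σ b ↔ σ.SameCycle b c := by
  rw [mem_periodicOrbit_iff (σ.mem_periodicPts b)]
  constructor
  · rintro ⟨n, rfl⟩
    exact ⟨n, by rw [← Equiv.Perm.coe_pow]; rfl⟩
  · intro h
    obtain ⟨n, -, hn⟩ := h.exists_pow_eq'
    exact ⟨n, by rw [← Equiv.Perm.coe_pow, hn]⟩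

theorem periodicOrbit_eq_iff_sameCycle (σ : Equiv.Perm B) (b c : B) :
    periodicOrbit σ b = periodicOrbit σ c ↔ σ.SameCycle b c := by
  rw [← mem_periodicOrbit_iff_sameCycle]
  refine ⟨fun h => h ▸ self_mem_periodicOrbit (σ.mem_periodicPts c),
    fun h => (periodicOrbit_eq_of_mem σ h).symm⟩

/-- Only the iterates at `b` matter; this allows a permutation to be altered away from the orbit of
`b`. -/
theorem periodicOrbit_congr {f g : B → B} {b : B} (h : ∀ n, f^[n] b = g^[n] b) :
    periodicOrbit f b = periodicOrbit g b := by
  have : minimalPeriod f b = minimalPeriod g b :=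
    minimalPeriod_eq_minimalPeriod_iff.mpr fun n => by simp [IsPeriodicPt, IsFixedPt, h]
  simp [periodicOrbit, this, h]

/-- Rotating the orbit list by one step is the same as applying `σ` to its entries, so each bond is
paired with its image. This turns cycle amplitudes into the products of the Leibniz formula. -/
theorem cycleAmplitude_periodicOrbit (S : Matrix B B ℂ) (σ : Equiv.Perm B) (b : B) :
    QuantumGraph.cycleAmplitude S (periodicOrbit σ b)
      = ((periodicOrbit σ b).toMultiset.map fun c => S (σ c) c).prod := by
  set l := (List.range (minimalPeriod σ b)).map fun n => σ^[n] b with hl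
  have hrot : l.rotate 1 = l.map σ := by
    refine List.ext_getElem (by simp) fun i h1 h2 => ?_
    have hlen : l.length = minimalPeriod σ b := by simp [hl]
    rw [List.getElem_rotate]
    simp only [hlen]
    simp only [hl, List.getElem_map, List.getElem_range]
    rw [iterate_mod_minimalPeriod_eq, iterate_succ_apply']
  change (List.zipWith (fun b b' => S b' b) l (l.rotate 1)).prod
    = (Multiset.map (fun c => S (σ c) c) (l : Multiset B)).prod
  rw [hrot, List.zipWith_map_right, List.zipWith_self, Multiset.map_coe, Multiset.prod_coe]

/-- The cycles of `σ` that meet `T`. -/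
noncomputable def orbitCycles (T : Finset B) (σ : Equiv.Perm B) : Finset (Cycle B) :=
  T.image fun b => periodicOrbit σ b

theorem periodicOrbit_mem_orbitCycles {T : Finset B} (σ : Equiv.Perm B) {b : B} (h : b ∈ T) :
    periodicOrbit σ b ∈ orbitCycles T σ :=
  Finset.mem_image_of_mem _ h

theorem mem_of_mem_periodicOrbit {T : Finset B} {σ : Equiv.Perm B} (h : ∀ b ∉ T, σ b = b)
    {b c : B} (hb : b ∈ T) (hc : c ∈ periodicOrbit σ b) : c ∈ T := by
  by_contra hcT
  have h1 := (mem_periodicOrbit_iff_sameCycle σ b c).mp hc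
  obtain ⟨n, hn⟩ := h1.symm
  have : (σ ^ n) c = c := Equiv.Perm.zpow_apply_eq_self_of_apply_eq_self (h c hcT) n
  exact hcT ((hn.symm.trans this) ▸ hb)

theorem bind_orbitCycles {T : Finset B} {σ : Equiv.Perm B} (h : ∀ b ∉ T, σ b = b) :
    (orbitCycles T σ).val.bind Cycle.toMultiset = T.val := by
  have hnd : ((orbitCycles T σ).val.bind Cycle.toMultiset).Nodup := by
    rw [Multiset.nodup_bind]
    constructor
    · intro γ hγ
      obtain ⟨b, -, rfl⟩ := Finset.mem_image.mp hγ
      exact nodup_periodicOrbit (f := σ) (x := b)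
    · refine (orbitCycles T σ).nodup.pairwise fun γ hγ γ' hγ' hne => ?_
      obtain ⟨b, -, rfl⟩ := Finset.mem_image.mp hγ
      obtain ⟨b', -, rfl⟩ := Finset.mem_image.mp hγ'
      refine Multiset.disjoint_left.mpr fun {c} hc hc' => hne ?_
      rw [← periodicOrbit_eq_of_mem σ (b := b) (c := c) hc,
        ← periodicOrbit_eq_of_mem σ (b := b') (c := c) hc']
  refine (Multiset.Nodup.ext hnd T.nodup).mpr fun c => ?_
  rw [Multiset.mem_bind]
  constructor
  · rintro ⟨γ, hγ, hc⟩
    obtain ⟨b, hb, rfl⟩ := Finset.mem_image.mp hγ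
    exact mem_of_mem_periodicOrbit h hb hc
  · intro hc
    exact ⟨_, periodicOrbit_mem_orbitCycles σ hc, self_mem_periodicOrbit (σ.mem_periodicPts c)⟩

/-- The set is recovered as the union of the cycles, and the permutation as the successor map on
them. -/
theorem orbitCycles_injective {T T' : Finset B} {σ σ' : Equiv.Perm B} (h : ∀ b ∉ T, σ b = b)
    (h' : ∀ b ∉ T', σ' b = b) (heq : orbitCycles T σ = orbitCycles T' σ') :
    T = T' ∧ σ = σ' := by
  have hT : T = T' := by
    rw [← Finset.val_inj, ← bind_orbitCycles h, ← bind_orbitCycles h', heq]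
  refine ⟨hT, Equiv.ext fun b => ?_⟩
  by_cases hb : b ∈ T
  · have h1 : periodicOrbit σ b = periodicOrbit σ' b := by
      have := periodicOrbit_mem_orbitCycles σ hb
      rw [heq] at this
      obtain ⟨c, -, hc⟩ := Finset.mem_image.mp this
      have hb' : b ∈ periodicOrbit σ' c := hc ▸ self_mem_periodicOrbit (σ.mem_periodicPts b)
      rw [periodicOrbit_eq_of_mem σ' hb', hc]
    -- The orbit is a cycle of `σ'` too, so consecutive entries are related by `σ'`; the first link
    -- reads `σ b = σ' b`.
    have h2 : (periodicOrbit σ b).Chain fun a c => c = σ' a := by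
      rw [h1, periodicOrbit_chain]
      intro n _
      exact iterate_succ_apply' _ _ _
    rw [periodicOrbit_chain' _ (σ.mem_periodicPts b)] at h2
    exact h2 0
  · rw [h b hb, h' b (hT ▸ hb)]

theorem periodicOrbit_eq_coe {f : B → B} {l : List B} (hl : l.Nodup)
    (h : ∀ i (hi : i < l.length),
      f l[i] = l[(i + 1) % l.length]'(Nat.mod_lt _ (i.zero_le.trans_lt hi))) {b : B} (hb : b ∈ l) :
    periodicOrbit f b = (l : Cycle B) := by
  obtain ⟨j, hj, rfl⟩ := List.getElem_of_mem hb
  have hpos : 0 < l.length := j.zero_le.trans_lt hj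
  have key : ∀ n, f^[n] l[j] = l[(j + n) % l.length]'(Nat.mod_lt _ hpos) := by
    intro n
    induction n with
    | zero => simp [Nat.mod_eq_of_lt hj]
    | succ n ih =>
      rw [iterate_succ_apply', ih, h]
      simp [add_assoc]
  have hper : minimalPeriod f l[j] = l.length := by
    have hiff : ∀ n, IsPeriodicPt f n l[j] ↔ l.length ∣ n := by
      intro n
      rw [IsPeriodicPt, IsFixedPt, key, hl.getElem_inj_iff]
      constructor
      · intro h1
        have h1 : j + n ≡ j + 0 [MOD l.length] := by
          simpa [Nat.ModEq, Nat.mod_eq_of_lt hj] using h1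
        exact (Nat.modEq_zero_iff_dvd).mp (Nat.ModEq.add_left_cancel' _ h1)
      · rintro ⟨c, rfl⟩
        simp [Nat.mod_eq_of_lt hj]
    exact Nat.dvd_antisymm (isPeriodicPt_iff_minimalPeriod_dvd.mp ((hiff _).mpr dvd_rfl))
      ((hiff _).mp (isPeriodicPt_minimalPeriod _ _))
  rw [periodicOrbit, hper, Cycle.coe_eq_coe]
  refine List.IsRotated.symm ⟨j, ?_⟩
  refine List.ext_getElem (by simp) fun i h1 h2 => ?_
  rw [List.getElem_rotate]
  simp [key, add_comm]

/-- Cycles are adjoined one at a time. A new cycle `l` is disjoint from `T`, so `σ` fixes its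
entries while `l.formPerm` fixes `T`; hence `l.formPerm * σ` acts as each factor on its own part. If
`l` has a single entry, `l.formPerm` is the identity and only the enlarged set records the new
cycle. -/
theorem exists_orbitCycles_eq (P : Multiset (Cycle B)) (hne : ∀ γ ∈ P, γ ≠ Cycle.nil)
    (hnd : (P.bind Cycle.toMultiset).Nodup) :
    ∃ (T : Finset B) (σ : Equiv.Perm B), (∀ b ∉ T, σ b = b) ∧ (orbitCycles T σ).val = P := by
  induction P using Multiset.induction with
  | empty => exact ⟨∅, 1, fun _ _ => rfl, rfl⟩
  | cons γ P ih =>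
    rw [Multiset.cons_bind, Multiset.nodup_add] at hnd
    obtain ⟨hγ, hP, hdis⟩ := hnd
    obtain ⟨T, σ, hσ, hTP⟩ := ih (fun γ hγ => hne γ (Multiset.mem_cons_of_mem hγ)) hP
    have hγne := hne γ (Multiset.mem_cons_self _ _)
    rw [← hTP, bind_orbitCycles hσ] at hdis
    induction γ using Quotient.inductionOn with
    | _ l =>
    change (l : Cycle B).toMultiset.Nodup at hγ
    change Disjoint (l : Cycle B).toMultiset _ at hdis
    change (l : Cycle B) ≠ _ at hγne
    change ∃ (T : Finset B) (σ : Equiv.Perm B), (∀ b ∉ T, σ b = b) ∧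
      (orbitCycles T σ).val = (l : Cycle B) ::ₘ P
    rw [Cycle.coe_toMultiset, Multiset.coe_nodup] at hγ
    have hdis : ∀ b ∈ l, b ∉ T := fun b hb hbT =>
      Multiset.disjoint_left.mp hdis (by simpa using hb : b ∈ _) hbT
    have hσT : ∀ b ∈ T, σ b ∈ T := fun b hb => by
      by_contra hc
      exact hc ((σ.injective (hσ _ hc)).symm ▸ hb)
    have hl : ∀ b ∈ l, periodicOrbit (l.formPerm * σ) b = (l : Cycle B) := by
      intro b hb
      refine periodicOrbit_eq_coe hγ (fun i hi => ?_) hb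
      rw [Equiv.Perm.mul_apply, hσ _ (hdis _ (List.getElem_mem hi)),
        List.formPerm_apply_getElem _ hγ]
    have hT : ∀ b ∈ T, periodicOrbit (l.formPerm * σ) b = periodicOrbit σ b := by
      intro b hb
      refine periodicOrbit_congr fun n => ?_
      have : (l.formPerm * σ)^[n] b = σ^[n] b ∧ σ^[n] b ∈ T := by
        induction n with
        | zero => exact ⟨rfl, hb⟩
        | succ n ih =>
          have h2 := hσT _ ih.2
          rw [iterate_succ_apply', iterate_succ_apply', ih.1, Equiv.Perm.mul_apply]
          exact ⟨List.formPerm_apply_of_notMem fun hm => hdis _ hm h2, h2⟩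
      exact this.1
    have hT' : orbitCycles T (l.formPerm * σ) = orbitCycles T σ := Finset.image_congr hT
    have hln : l ≠ [] := fun h => hγne (by rw [h]; rfl)
    have hl' : orbitCycles l.toFinset (l.formPerm * σ) = {(l : Cycle B)} := by
      ext γ
      simp only [orbitCycles, Finset.mem_image, List.mem_toFinset, Finset.mem_singleton]
      constructor
      · rintro ⟨b, hb, rfl⟩
        exact hl b hb
      · rintro rfl
        exact ⟨l.head hln, List.head_mem hln, hl _ (List.head_mem hln)⟩
    refine ⟨l.toFinset ∪ T, l.formPerm * σ, fun b hb => ?_, ?_⟩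
    · simp only [Finset.mem_union, List.mem_toFinset, not_or] at hb
      rw [Equiv.Perm.mul_apply, hσ _ hb.2, List.formPerm_apply_of_notMem hb.1]
    · have : orbitCycles (l.toFinset ∪ T) (l.formPerm * σ)
          = insert (l : Cycle B) (orbitCycles T σ) := by
        rw [orbitCycles, Finset.image_union, ← orbitCycles, ← orbitCycles, hl', hT']
        rfl
      rw [this, Finset.insert_val_of_notMem, hTP]
      intro hmem
      obtain ⟨b, hb, hbl⟩ := Finset.mem_image.mp hmem
      have : b ∈ (l : Cycle B) := hbl ▸ self_mem_periodicOrbit (σ.mem_periodicPts b)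
      exact hdis b (by simpa using this) hb

/-- The orbits in `T` are the nontrivial cycles of `σ` together with one orbit for each fixed point
in `T`. The identity is arranged as a sum to avoid subtraction in ℕ. -/
theorem card_orbitCycles {T : Finset B} {σ : Equiv.Perm B} (h : ∀ b ∉ T, σ b = b) :
    (orbitCycles T σ).card + σ.support.card = Multiset.card σ.cycleType + T.card := by
  have hsub : σ.support ⊆ T := fun b hb => by
    by_contra hc
    exact Equiv.Perm.mem_support.mp hb (h b hc)
  have h1 : (σ.support.image fun b => periodicOrbit σ b).card = Multiset.card σ.cycleType := by
    have h2 : σ.cycleFactorsFinset = σ.support.image fun b => σ.cycleOf b := by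
      ext c
      rw [Finset.mem_image]
      constructor
      · intro hc
        obtain ⟨hcyc, hca⟩ := Equiv.Perm.mem_cycleFactorsFinset_iff.mp hc
        obtain ⟨b, hb, -⟩ := id hcyc
        have hb' : b ∈ c.support := Equiv.Perm.mem_support.mpr hb
        refine ⟨b, Equiv.Perm.mem_cycleFactorsFinset_support_le hc hb', ?_⟩
        exact (Equiv.Perm.cycle_is_cycleOf hb' hc).symm
      · rintro ⟨b, hb, rfl⟩
        exact Equiv.Perm.cycleOf_mem_cycleFactorsFinset_iff.mpr hb
    rw [Equiv.Perm.cycleType_def, Multiset.card_map, Finset.card_val, h2]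
    -- Periodic orbits and cycle factors are both images of the support, under maps with the same
    -- fibres: the classes of `SameCycle`.
    refine Finset.card_bij' (fun γ hγ => σ.cycleOf (Finset.mem_image.mp hγ).choose)
      (fun c hc => periodicOrbit σ (Finset.mem_image.mp hc).choose) ?_ ?_ ?_ ?_
    · intro γ hγ
      exact Finset.mem_image_of_mem _ (Finset.mem_image.mp hγ).choose_spec.1
    · intro γ hγ
      exact Finset.mem_image_of_mem _ (Finset.mem_image.mp hγ).choose_spec.1
    · intro γ hγ
      have s1 := (Finset.mem_image.mp hγ).choose_spec
      have s2 := (Finset.mem_image.mp (Finset.mem_image_of_mem (fun b => σ.cycleOf b)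
        s1.1)).choose_spec
      refine Eq.trans ?_ s1.2
      exact (periodicOrbit_eq_iff_sameCycle σ _ _).mpr
        ((Equiv.Perm.sameCycle_iff_cycleOf_eq_of_mem_support s2.1 s1.1).mpr s2.2)
    · intro γ hγ
      have s1 := (Finset.mem_image.mp hγ).choose_spec
      have s2 := (Finset.mem_image.mp (Finset.mem_image_of_mem (fun b => periodicOrbit σ b)
        s1.1)).choose_spec
      refine Eq.trans ?_ s1.2
      exact (Equiv.Perm.sameCycle_iff_cycleOf_eq_of_mem_support s2.1 s1.1).mp
        ((periodicOrbit_eq_iff_sameCycle σ _ _).mp s2.2)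
  have h3 : ((T \ σ.support).image fun b => periodicOrbit σ b).card = (T \ σ.support).card := by
    refine Finset.card_image_of_injOn fun b hb c hc hbc => ?_
    have hb' : σ b = b := by simpa using (Finset.mem_sdiff.mp (Finset.mem_coe.mp hb)).2
    obtain ⟨n, hn⟩ := (periodicOrbit_eq_iff_sameCycle σ b c).mp hbc
    rw [← hn, Equiv.Perm.zpow_apply_eq_self_of_apply_eq_self hb' n]
  have h4 : Disjoint (σ.support.image fun b => periodicOrbit σ b)
      ((T \ σ.support).image fun b => periodicOrbit σ b) := by
    refine Finset.disjoint_left.mpr fun γ hγ hγ' => ?_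
    obtain ⟨b, hb, rfl⟩ := Finset.mem_image.mp hγ
    obtain ⟨c, hc, hbc⟩ := Finset.mem_image.mp hγ'
    have hc' : σ c = c := by simpa using (Finset.mem_sdiff.mp hc).2
    obtain ⟨n, hn⟩ := (periodicOrbit_eq_iff_sameCycle σ c b).mp hbc
    rw [Equiv.Perm.zpow_apply_eq_self_of_apply_eq_self hc' n] at hn
    exact (Finset.mem_sdiff.mp hc).2 (hn ▸ hb)
  have h5 : orbitCycles T σ = (σ.support.image fun b => periodicOrbit σ b) ∪
      ((T \ σ.support).image fun b => periodicOrbit σ b) := by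
    rw [← Finset.image_union, Finset.union_sdiff_of_subset hsub, orbitCycles]
  rw [h5, Finset.card_union_of_disjoint h4, h1, h3, Finset.card_sdiff_of_subset hsub]
  have := Finset.card_le_card hsub
  omega

theorem sign_mul_neg_one_pow_card {T : Finset B} {σ : Equiv.Perm B} (h : ∀ b ∉ T, σ b = b) :
    ((Equiv.Perm.sign σ : ℤ) : ℂ) * (-1) ^ T.card = (-1) ^ (orbitCycles T σ).card := by
  have h1 := card_orbitCycles h
  rw [Equiv.Perm.sign_of_cycleType, Equiv.Perm.sum_cycleType]
  push_cast
  rw [← pow_add, add_assoc, ← h1, add_comm, add_assoc, ← two_mul, pow_add, pow_mul]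
  simp

/-- In the Leibniz formula each factor is `-M (σ b) b` plus a Kronecker delta. Multiplying out, `T`
collects the bonds where the first summand is chosen, and the deltas on the complement vanish unless
`σ` fixes it. The set `T` is kept besides `σ` because a fixed point may or may not be counted as an
orbit of length one. -/
theorem det_one_sub_eq_sum (M : Matrix B B ℂ) :
    (1 - M).det = ∑ p : Finset B × Equiv.Perm B with ∀ b ∉ p.1, p.2 b = b,
      ((Equiv.Perm.sign p.2 : ℤ) : ℂ) * (-1) ^ p.1.card * ∏ b ∈ p.1, M (p.2 b) b := by
  have h1 : ∀ σ : Equiv.Perm B, ∏ b, (1 - M) (σ b) b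
      = ∑ T : Finset B, if ∀ b ∉ T, σ b = b then (-1) ^ T.card * ∏ b ∈ T, M (σ b) b else 0 := by
    intro σ
    have : ∀ b, (1 - M) (σ b) b = -M (σ b) b + (1 : Matrix B B ℂ) (σ b) b := fun b => by
      rw [Matrix.sub_apply]; ring
    simp_rw [this]
    rw [Fintype.prod_add]
    refine Finset.sum_congr rfl fun T _ => ?_
    rw [Finset.prod_neg]
    split_ifs with h
    · rw [Finset.prod_eq_one (s := Tᶜ), mul_one]
      intro b hb
      rw [h b (by simpa using hb), Matrix.one_apply_eq]
    · push Not at h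
      obtain ⟨b, hb, hb'⟩ := h
      have h0 : ∏ b ∈ Tᶜ, (1 : Matrix B B ℂ) (σ b) b = 0 :=
        Finset.prod_eq_zero (Finset.mem_compl.mpr hb) (Matrix.one_apply_ne hb')
      rw [h0, mul_zero]
  rw [Matrix.det_apply', Finset.sum_filter, Fintype.sum_prod_type_right]
  refine Finset.sum_congr rfl fun σ _ => ?_
  rw [h1, Finset.mul_sum]
  refine Finset.sum_congr rfl fun T _ => ?_
  simp only [mul_ite, mul_zero, mul_assoc]

end Orbits

/-! ### The resonance function as a secular determinant -/

namespace QuantumGraph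

open Function

variable {V E X : Type*} [Fintype E] [Fintype X] [DecidableEq V] [DecidableEq E] [DecidableEq X]

theorem rev_rev (b : E × Bool) : rev (rev b) = b := by
  simp [rev]

theorem scattering_apply (G : QuantumGraph V E X) (k : ℂ) (b' b : E × Bool) :
    G.scattering k b' b = G.bigSigma k (rev b') b := by
  rw [scattering, Matrix.mul_apply, Finset.sum_eq_single (rev b')]
  · simp [bondSwap, rev_rev]
  · intro c _ hc
    have : b' ≠ rev c := fun h => hc (by rw [h, rev_rev])
    simp [bondSwap, this]
  · simp

theorem scattering_eq_zero (G : QuantumGraph V E X) (k : ℂ) {b' b : E × Bool}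
    (h : G.vert (rev b) ≠ G.vert b') : G.scattering k b' b = 0 := by
  rw [scattering_apply, bigSigma, dif_neg]
  rw [rev_rev]
  exact h.symm

/-- The diagonal matrix of the phases that a wave picks up along the bonds. -/
noncomputable def phases (ℓ : E → ℝ) (k : ℂ) : Matrix (E × Bool) (E × Bool) ℂ :=
  Matrix.diagonal fun b => Complex.exp (Complex.I * k * (ℓ b.1 : ℂ))

theorem isIrreduciblePseudoOrbit_orbitCycles (G : QuantumGraph V E X) {T : Finset (E × Bool)}
    {σ : Equiv.Perm (E × Bool)} (h : ∀ b ∉ T, σ b = b)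
    (hadm : ∀ b ∈ T, G.vert (rev b) = G.vert (σ b)) :
    G.IsIrreduciblePseudoOrbit (orbitCycles T σ).val := by
  refine ⟨fun γ hγ => ?_, bind_orbitCycles h ▸ T.nodup⟩
  obtain ⟨b, hb, rfl⟩ := Finset.mem_image.mp hγ
  refine ⟨fun hnil => (periodicOrbit_eq_nil_iff_not_periodic_pt.mp hnil) (σ.mem_periodicPts b), ?_⟩
  rw [periodicOrbit_chain' _ (σ.mem_periodicPts b)]
  intro n
  rw [iterate_succ_apply']
  exact hadm _ (mem_of_mem_periodicOrbit h hb (iterate_mem_periodicOrbit (σ.mem_periodicPts b) n))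

theorem pseudoOrbit_term (G : QuantumGraph V E X) (ℓ : E → ℝ) (k : ℂ) (P : G.PseudoOrbit)
    {T : Finset (E × Bool)} {σ : Equiv.Perm (E × Bool)} (h : ∀ b ∉ T, σ b = b)
    (hP : P.1 = (orbitCycles T σ).val) :
    P.sign * P.amplitude k * Complex.exp (Complex.I * k * (P.length ℓ : ℂ)) =
      ((Equiv.Perm.sign σ : ℤ) : ℂ) * (-1) ^ T.card *
        ∏ b ∈ T, (G.scattering k * phases ℓ k) (σ b) b := by
  have h1 : P.sign = ((Equiv.Perm.sign σ : ℤ) : ℂ) * (-1) ^ T.card := by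
    rw [sign_mul_neg_one_pow_card h, PseudoOrbit.sign, hP, Finset.card_val]
  have h2 : P.amplitude k = ∏ b ∈ T, G.scattering k (σ b) b := by
    rw [PseudoOrbit.amplitude, hP, Finset.prod_eq_multiset_prod, ← bind_orbitCycles h,
      Multiset.map_bind, Multiset.prod_bind]
    refine congrArg _ (Multiset.map_congr rfl fun γ hγ => ?_)
    obtain ⟨b, -, rfl⟩ := Finset.mem_image.mp hγ
    exact cycleAmplitude_periodicOrbit _ σ b
  have h3 : P.length ℓ = ∑ b ∈ T, ℓ b.1 := by
    rw [PseudoOrbit.length, hP, Finset.sum_eq_multiset_sum, ← bind_orbitCycles h,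
      Multiset.map_bind, Multiset.sum_bind]
  have h4 : Complex.exp (Complex.I * k * (P.length ℓ : ℂ))
      = ∏ b ∈ T, Complex.exp (Complex.I * k * (ℓ b.1 : ℂ)) := by
    rw [h3, ← Complex.exp_sum, Complex.ofReal_sum, Finset.mul_sum]
  rw [h1, h2, h4, mul_assoc, ← Finset.prod_mul_distrib]
  refine congrArg _ (Finset.prod_congr rfl fun b _ => ?_)
  rw [phases, Matrix.mul_diagonal]

/-- The resonance function is the secular determinant `det (I - S D)`. -/
theorem resonanceFunction_eq_det (G : QuantumGraph V E X) (ℓ : E → ℝ) (k : ℂ) :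
    G.resonanceFunction ℓ k = (1 - G.scattering k * phases ℓ k).det := by
  rw [det_one_sub_eq_sum, resonanceFunction]
  symm
  -- Only pairs for which each bond of `T` ends where its image starts correspond to pseudo-orbits.
  -- All other pairs contain a vanishing entry of the scattering matrix.
  have hsub : (Finset.univ.filter fun p : Finset (E × Bool) × Equiv.Perm (E × Bool) =>
      (∀ b ∉ p.1, p.2 b = b) ∧ ∀ b ∈ p.1, G.vert (rev b) = G.vert (p.2 b)) ⊆
      Finset.univ.filter fun p => ∀ b ∉ p.1, p.2 b = b :=
    fun p hp => by
      simp only [Finset.mem_filter, Finset.mem_univ, true_and] at hp ⊢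
      exact hp.1
  rw [← Finset.sum_subset hsub]
  · refine Finset.sum_bij (fun p hp => ⟨(orbitCycles p.1 p.2).val, ?_⟩) ?_ ?_ ?_ ?_
    · have hp' := (Finset.mem_filter.mp hp).2
      exact G.isIrreduciblePseudoOrbit_orbitCycles hp'.1 hp'.2
    · intro p hp
      exact Finset.mem_univ _
    · intro p hp p' hp' heq
      have h1 := (Finset.mem_filter.mp hp).2
      have h2 := (Finset.mem_filter.mp hp').2
      exact Prod.ext_iff.mpr (orbitCycles_injective h1.1 h2.1
        (Finset.val_inj.mp (congrArg Subtype.val heq)))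
    · rintro ⟨P, hP⟩ -
      obtain ⟨T, σ, hσ, hTP⟩ := exists_orbitCycles_eq P (fun γ hγ => (hP.1 γ hγ).1) hP.2
      refine ⟨(T, σ), Finset.mem_filter.mpr ⟨Finset.mem_univ _, hσ, fun b hb => ?_⟩,
        Subtype.ext hTP⟩
      have h1 := (hP.1 (periodicOrbit σ b) (hTP ▸ periodicOrbit_mem_orbitCycles σ hb)).2
      exact (periodicOrbit_chain' _ (σ.mem_periodicPts b)).mp h1 0
    · intro p hp
      exact (G.pseudoOrbit_term ℓ k _ (Finset.mem_filter.mp hp).2.1 rfl).symm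
  · intro p hp hp'
    have h1 := (Finset.mem_filter.mp hp).2
    have h2 : ∃ b ∈ p.1, G.vert (rev b) ≠ G.vert (p.2 b) := by
      by_contra hc
      push Not at hc
      exact hp' (Finset.mem_filter.mpr ⟨Finset.mem_univ _, h1, hc⟩)
    obtain ⟨b, hb, hne⟩ := h2
    rw [Finset.prod_eq_zero hb, mul_zero]
    rw [phases, Matrix.mul_diagonal, G.scattering_eq_zero k hne, zero_mul]

end QuantumGraph

/-! ### Consequences of unitarity at a single vertex -/

section VertexCoupling

variable {n m : Type*} [Fintype n] [Fintype m] [DecidableEq n] [DecidableEq m]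

theorem normSq_sub_I_mul_sub_normSq_add_I_mul (a b : ℂ) :
    ‖a - Complex.I * b‖ ^ 2 - ‖a + Complex.I * b‖ ^ 2 = 4 * (star a * b).im := by
  simp only [← Complex.normSq_eq_norm_sq, Complex.normSq_apply]
  simp
  ring

/-- The boundary form vanishes on a coupling given by a unitary matrix. -/
theorem sum_im_star_mul_eq_zero_of_coupling {U : Matrix n n ℂ}
    (hU : U ∈ Matrix.unitaryGroup n ℂ) {ψ ψ' : n → ℂ}
    (h : (U - 1).mulVec ψ + Complex.I • (U + 1).mulVec ψ' = 0) :
    ∑ i, (star (ψ i) * ψ' i).im = 0 := by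
  -- The coupling condition in this form lets unitarity equate two norms, whose difference is the
  -- boundary form by polarization.
  have h1 : U.mulVec (ψ + Complex.I • ψ') = ψ - Complex.I • ψ' := by
    rw [Matrix.sub_mulVec, Matrix.add_mulVec, Matrix.one_mulVec, Matrix.one_mulVec] at h
    rw [Matrix.mulVec_add, Matrix.mulVec_smul, ← sub_eq_zero, ← h]
    rw [smul_add]
    abel
  have h2 := sum_norm_sq_unitary hU (ψ + Complex.I • ψ')
  rw [h1] at h2
  have h3 : ∑ i, 4 * (star (ψ i) * ψ' i).im = 0 := by
    simp_rw [← normSq_sub_I_mul_sub_normSq_add_I_mul]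
    rw [Finset.sum_sub_distrib, sub_eq_zero]
    exact h2
  rw [← Finset.mul_sum] at h3
  linarith

/-- The matrix is the Schur complement of the lead block in `(1-k) U - (1+k) I`. Both the full
matrix and the lead block are invertible, because `U` and its compression to the leads are
contractions. -/
theorem isUnit_det_effectiveCoupling {U : Matrix (n ⊕ m) (n ⊕ m) ℂ}
    (hU : U ∈ Matrix.unitaryGroup _ ℂ) {k : ℂ} (hk : 0 < k.re) :
    IsUnit ((1 - k) • effectiveCoupling U k - (1 + k) • (1 : Matrix n n ℂ)).det := by
  have hD0 := isUnit_det_of_contraction _ (sum_norm_sq_block_le hU) hk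
  have hF0 := isUnit_det_of_contraction U (fun x => (sum_norm_sq_unitary hU x).le) hk
  unfold effectiveCoupling
  rw [add_comm k 1]
  set D := (1 - k) • U.toBlocks₂₂ - (1 + k) • (1 : Matrix m m ℂ) with hDdef
  have hB : (1 - k) • U - (1 + k) • (1 : Matrix (n ⊕ m) (n ⊕ m) ℂ)
      = Matrix.fromBlocks ((1 - k) • U.toBlocks₁₁ - (1 + k) • 1) ((1 - k) • U.toBlocks₁₂)
        ((1 - k) • U.toBlocks₂₁) D := by
    conv_lhs => rw [← Matrix.fromBlocks_toBlocks U, ← Matrix.fromBlocks_one]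
    rw [Matrix.fromBlocks_smul, Matrix.fromBlocks_smul, sub_eq_add_neg, Matrix.fromBlocks_neg,
      Matrix.fromBlocks_add]
    simp [hDdef, sub_eq_add_neg]
  rw [hB] at hF0
  have := Matrix.invertibleOfIsUnitDet D hD0
  rw [Matrix.det_fromBlocks₂₂, IsUnit.mul_iff] at hF0
  convert hF0.2 using 2
  rw [Matrix.invOf_eq_nonsing_inv]
  simp only [smul_sub, Matrix.smul_mul, Matrix.mul_smul, smul_smul]
  abel

end VertexCoupling

/-! ### Analyticity of matrix functions -/

section AnalyticMatrix

variable {n m l : Type*} [Fintype n] [Fintype m] [DecidableEq n] [DecidableEq m]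

/-- All entries of the matrix function `A` are analytic at `z`. -/
def AnalyticEntries {n m : Type*} (A : ℂ → Matrix n m ℂ) (z : ℂ) : Prop :=
  ∀ i j, AnalyticAt ℂ (fun k => A k i j) z

theorem AnalyticEntries.const (A : Matrix n m ℂ) (z : ℂ) : AnalyticEntries (fun _ => A) z :=
  fun _ _ => analyticAt_const

theorem AnalyticEntries.sub {A B : ℂ → Matrix n m ℂ} {z : ℂ} (hA : AnalyticEntries A z)
    (hB : AnalyticEntries B z) : AnalyticEntries (fun k => A k - B k) z :=
  fun i j => (hA i j).sub (hB i j)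

theorem AnalyticEntries.neg {A : ℂ → Matrix n m ℂ} {z : ℂ} (hA : AnalyticEntries A z) :
    AnalyticEntries (fun k => -A k) z :=
  fun i j => (hA i j).neg

theorem AnalyticEntries.smul {A : ℂ → Matrix n m ℂ} {f : ℂ → ℂ} {z : ℂ} (hf : AnalyticAt ℂ f z)
    (hA : AnalyticEntries A z) : AnalyticEntries (fun k => f k • A k) z :=
  fun i j => hf.mul (hA i j)

theorem AnalyticEntries.mul {A : ℂ → Matrix l m ℂ} {B : ℂ → Matrix m n ℂ} {z : ℂ}
    (hA : AnalyticEntries A z) (hB : AnalyticEntries B z) :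
    AnalyticEntries (fun k => A k * B k) z := by
  intro i j
  simp only [Matrix.mul_apply]
  exact Finset.analyticAt_fun_sum _ fun c _ => (hA i c).mul (hB c j)

theorem AnalyticEntries.det {A : ℂ → Matrix n n ℂ} {z : ℂ} (hA : AnalyticEntries A z) :
    AnalyticAt ℂ (fun k => (A k).det) z := by
  simp only [Matrix.det_apply']
  exact Finset.analyticAt_fun_sum _ fun σ _ =>
    analyticAt_const.mul (Finset.analyticAt_fun_prod _ fun i _ => hA _ _)

theorem AnalyticEntries.inv {A : ℂ → Matrix n n ℂ} {z : ℂ} (hA : AnalyticEntries A z)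
    (hdet : IsUnit (A z).det) : AnalyticEntries (fun k => (A k)⁻¹) z := by
  intro i j
  simp only [Matrix.inv_def, Matrix.smul_apply, smul_eq_mul, Ring.inverse_eq_inv',
    Matrix.adjugate_apply]
  refine (hA.det.inv hdet.ne_zero).mul (AnalyticEntries.det fun a b => ?_)
  simp only [Matrix.updateRow_apply]
  split_ifs
  · exact analyticAt_const
  · exact hA a b

/-- Both inverses in the definition exist throughout the right half-plane, so no poles of the
amplitudes can occur there. -/
theorem analyticEntries_effectiveScattering {U : Matrix (n ⊕ m) (n ⊕ m) ℂ}
    (hU : U ∈ Matrix.unitaryGroup _ ℂ) {z : ℂ} (hz : 0 < z.re) :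
    AnalyticEntries (effectiveScattering U) z := by
  have hm : AnalyticAt ℂ (fun k : ℂ => 1 - k) z := by fun_prop
  have hp : AnalyticAt ℂ (fun k : ℂ => 1 + k) z := by fun_prop
  have hp' : AnalyticAt ℂ (fun k : ℂ => k + 1) z := by fun_prop
  have hc : AnalyticEntries (effectiveCoupling U) z := by
    refine (AnalyticEntries.const _ z).sub (.smul hm (.mul (.mul (.const _ z)
      (.inv (.sub (.smul hm (.const _ z)) (.smul hp' (.const _ z))) ?_)) (.const _ z)))
    rw [add_comm]
    exact isUnit_det_of_contraction _ (sum_norm_sq_block_le hU) hz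
  exact ((((AnalyticEntries.smul hm hc).sub (.smul hp (.const _ z))).inv
    (isUnit_det_effectiveCoupling hU hz)).mul
      ((AnalyticEntries.smul hp hc).sub (.smul hm (.const _ z)))).neg

end AnalyticMatrix

/-! ### Amplitudes on the graph, coupling conditions and flux -/

namespace QuantumGraph

variable {V E X : Type*} [Fintype E] [Fintype X] [DecidableEq V] [DecidableEq E] [DecidableEq X]

theorem analyticEntries_scattering (G : QuantumGraph V E X) {z : ℂ} (hz : 0 < z.re) :
    AnalyticEntries G.scattering z := by
  intro b' b
  simp only [scattering_apply, bigSigma]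
  split_ifs with h
  · exact analyticEntries_effectiveScattering (G.unitary _) hz _ _
  · exact analyticAt_const

theorem analyticAt_amplitude {G : QuantumGraph V E X} (P : G.PseudoOrbit) {z : ℂ}
    (hz : 0 < z.re) : AnalyticAt ℂ P.amplitude z := by
  have hcycle : ∀ γ : Cycle (E × Bool),
      AnalyticAt ℂ (fun k => cycleAmplitude (G.scattering k) γ) z := by
    intro γ
    induction γ using Quotient.inductionOn with
    | _ l =>
    change AnalyticAt ℂ (fun k =>
      (List.zipWith (fun b b' => G.scattering k b' b) l (l.rotate 1)).prod) z
    generalize l.rotate 1 = l'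
    induction l generalizing l' with
    | nil => exact analyticAt_const
    | cons a l ih =>
      cases l' with
      | nil => exact analyticAt_const
      | cons a' l' =>
        simp only [List.zipWith_cons_cons, List.prod_cons]
        exact (G.analyticEntries_scattering hz a' a).mul (ih l')
  unfold PseudoOrbit.amplitude
  induction P.1 using Multiset.induction with
  | empty => exact analyticAt_const
  | cons γ P ih =>
    simp only [Multiset.map_cons, Multiset.prod_cons]
    exact (hcycle γ).mul ih

/-- The wave with outgoing amplitudes `v` and incoming amplitudes `u` at the ends of the internal
edges, and with amplitudes `b` on the leads, satisfies the coupling conditions. -/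
def AmplitudeCoupling (G : QuantumGraph V E X) (k : ℂ) (u v : E × Bool → ℂ) (b : X → ℂ) : Prop :=
  ∀ w, (G.U w - 1).mulVec (Sum.elim (fun p => u p.1 + v p.1) (fun x => b x.1)) +
    Complex.I • (G.U w + 1).mulVec (Sum.elim (fun p => Complex.I * k * (v p.1 - u p.1))
      (fun x => Complex.I * k * b x.1)) = 0

/-- The amplitudes that arrive at the edge ends if the amplitudes `v` leave them. -/
noncomputable def incoming (ℓ : E → ℝ) (k : ℂ) (v : E × Bool → ℂ) (p : E × Bool) : ℂ :=
  Complex.exp (Complex.I * k * (ℓ p.1 : ℂ)) * v (rev p)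

theorem scattering_rev_apply (G : QuantumGraph V E X) (k : ℂ) (w : V)
    (p q : {p : E × Bool // G.vert p = w}) :
    G.scattering k p.1 (rev q.1) = effectiveScattering (G.U w) k p q := by
  -- The entries are indexed by a subtype that depends on the vertex of `rev (rev q)`; generalizing
  -- over the ends makes the substitution possible.
  have key : ∀ a c : E × Bool, a = p.1 → c = q.1 →
      (if h : G.vert a = G.vert c then
        effectiveScattering (G.U (G.vert c)) k ⟨a, h⟩ ⟨c, rfl⟩ else 0) =
      effectiveScattering (G.U w) k p q := by
    rintro a c rfl rfl
    obtain ⟨q, rfl⟩ := q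
    rw [dif_pos p.2]
  rw [scattering_apply]
  exact key _ _ (rev_rev _) (rev_rev _)

theorem scattering_mulVec_apply (G : QuantumGraph V E X) (ℓ : E → ℝ) (k : ℂ) (v : E × Bool → ℂ)
    (w : V) (p : {p : E × Bool // G.vert p = w}) :
    (G.scattering k * phases ℓ k).mulVec v p.1 =
      (effectiveScattering (G.U w) k).mulVec (fun q => incoming ℓ k v q.1) p := by
  have h1 : (G.scattering k * phases ℓ k).mulVec v p.1
      = ∑ q, G.scattering k p.1 (rev q) * incoming ℓ k v q := by
    rw [Matrix.mulVec, dotProduct]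
    refine Fintype.sum_equiv (Function.Involutive.toPerm rev rev_rev) _ _ fun b => ?_
    change _ = G.scattering k p.1 (rev (rev b)) * incoming ℓ k v (rev b)
    rw [rev_rev, phases, Matrix.mul_diagonal, incoming, rev_rev, mul_assoc]
    rfl
  rw [h1, Matrix.mulVec, dotProduct,
    ← Finset.sum_subset (Finset.subset_univ (Finset.univ.filter fun q => G.vert q = w)),
    Finset.sum_subtype (p := fun q => G.vert q = w) _ (by simp)]
  · refine Finset.sum_congr rfl fun q _ => ?_
    rw [scattering_rev_apply]
  · intro q _ hq
    rw [scattering_eq_zero, zero_mul]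
    rw [rev_rev, p.2]
    simpa using hq

/-- This is the dictionary between linear algebra and waves: `effectiveScattering_spec` is applied
at each vertex, and the lead amplitudes glue since a lead starts in exactly one vertex. The result
`v'` is not required to equal `v`, because the resolvent estimate needs the general case. -/
theorem scattering_mulVec_eq_iff (G : QuantumGraph V E X) (ℓ : E → ℝ) {k : ℂ} (hk : 0 < k.re)
    (v v' : E × Bool → ℂ) :
    (G.scattering k * phases ℓ k).mulVec v = v' ↔
      ∃ b, G.AmplitudeCoupling k (incoming ℓ k v) v' b := by
  have key : ∀ w, (∀ p : {p : E × Bool // G.vert p = w},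
      (G.scattering k * phases ℓ k).mulVec v p.1 = v' p.1) ↔
      ∃ b : {x : X // G.leadVert x = w} → ℂ, (G.U w - 1).mulVec
        (Sum.elim (fun p => incoming ℓ k v p.1 + v' p.1) b) +
        Complex.I • (G.U w + 1).mulVec (Sum.elim
          (fun p => Complex.I * k * (v' p.1 - incoming ℓ k v p.1))
          (fun x => Complex.I * k * b x)) = 0 := by
    intro w
    refine Iff.trans ?_ (effectiveScattering_spec (G.unitary w) hk
      (fun p => incoming ℓ k v p.1) (fun p => v' p.1))
    rw [funext_iff]
    refine forall_congr' fun p => ?_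
    rw [scattering_mulVec_apply, eq_comm]
  constructor
  · intro h
    have h1 := fun w => (key w).mp fun p => congrFun h p.1
    choose b hb using h1
    refine ⟨fun x => b (G.leadVert x) ⟨x, rfl⟩, fun w => ?_⟩
    have h2 : (fun x : {x : X // G.leadVert x = w} => b (G.leadVert x.1) ⟨x.1, rfl⟩) = b w := by
      funext x
      obtain ⟨x, rfl⟩ := x
      rfl
    convert hb w using 5
    · funext x
      rw [← h2]
  · rintro ⟨b, hb⟩
    funext p
    exact (key (G.vert p)).mpr ⟨_, hb (G.vert p)⟩ ⟨p, rfl⟩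

/-- The vertex type need not be finite, so the sum runs over the finitely many vertices that carry
an edge end or a lead. -/
theorem sum_add_sum_eq_zero_of_vertices (G : QuantumGraph V E X) {f : E × Bool → ℝ} {g : X → ℝ}
    (h : ∀ w, ∑ p : {p : E × Bool // G.vert p = w}, f p.1 +
      ∑ x : {x : X // G.leadVert x = w}, g x.1 = 0) :
    ∑ p, f p + ∑ x, g x = 0 := by
  classical
  set s : Finset V := Finset.univ.image G.vert ∪ Finset.univ.image G.leadVert with hs
  rw [← Finset.sum_fiberwise_of_maps_to (t := s) (g := G.vert) (by simp [hs]),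
    ← Finset.sum_fiberwise_of_maps_to (t := s) (s := Finset.univ) (g := G.leadVert) (by simp [hs]),
    ← Finset.sum_add_distrib]
  refine Finset.sum_eq_zero fun w _ => ?_
  rw [Finset.sum_subtype (p := fun p => G.vert p = w) _ (by simp),
    Finset.sum_subtype (p := fun x => G.leadVert x = w) _ (by simp)]
  exact h w

/-- Conservation of the flux through the vertices. -/
theorem AmplitudeCoupling.flux {G : QuantumGraph V E X} {k : ℂ} {u v : E × Bool → ℂ} {b : X → ℂ}
    (h : G.AmplitudeCoupling k u v b) :
    k.re * (∑ p, ‖v p‖ ^ 2 - ∑ p, ‖u p‖ ^ 2) + k.re * ∑ x, ‖b x‖ ^ 2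
      = 2 * k.im * ∑ p, (v p * star (u p)).im := by
  have h1 := G.sum_add_sum_eq_zero_of_vertices
    (f := fun p => (star (u p + v p) * (Complex.I * k * (v p - u p))).im)
    (g := fun x => (star (b x) * (Complex.I * k * b x)).im) (fun w => by
      have := sum_im_star_mul_eq_zero_of_coupling (G.unitary w) (h w)
      rwa [Fintype.sum_sum_type] at this)
  have h2 : ∀ p, (star (u p + v p) * (Complex.I * k * (v p - u p))).im
      = k.re * ‖v p‖ ^ 2 - k.re * ‖u p‖ ^ 2 - 2 * k.im * (v p * star (u p)).im := by
    intro p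
    simp only [← Complex.normSq_eq_norm_sq, Complex.normSq_apply]
    simp
    ring
  have h3 : ∀ x, (star (b x) * (Complex.I * k * b x)).im = k.re * ‖b x‖ ^ 2 := by
    intro x
    simp only [← Complex.normSq_eq_norm_sq, Complex.normSq_apply]
    simp
    ring
  simp_rw [h2, h3, Finset.sum_sub_distrib, ← Finset.mul_sum] at h1
  linarith

end QuantumGraph

/-! ### Energy estimates in the upper half-plane -/

theorem Real.abs_sin_lt_self {x : ℝ} (hx : 0 < x) : |Real.sin x| < x := by
  refine abs_lt.mpr ⟨?_, Real.sin_lt hx⟩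
  rcases le_total x Real.pi with h | h
  · linarith [Real.sin_nonneg_of_nonneg_of_le_pi hx.le h]
  · linarith [Real.neg_one_le_sin x, Real.pi_gt_three]

theorem edge_gap_pos {κ L : ℝ} (hκ : 0 < κ) (hL : 0 < L) : 0 < L - |Real.sin (κ * L)| / κ := by
  have := Real.abs_sin_lt_self (mul_pos hκ hL)
  rw [sub_pos, div_lt_iff₀ hκ]
  linarith

/-- This is `s ≤ sinh s` multiplied by `2 e^{-s}`. -/
theorem two_mul_self_mul_exp_neg_le {s : ℝ} (hs : 0 ≤ s) :
    2 * s * Real.exp (-s) ≤ 1 - Real.exp (-s) ^ 2 := by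
  have h1 := Real.self_le_sinh_iff.mpr hs
  rw [Real.sinh_eq] at h1
  have h2 : Real.exp s * Real.exp (-s) = 1 := by rw [← Real.exp_add]; simp
  have h3 := Real.exp_pos (-s)
  nlinarith

/-- The estimate behind the positivity of `∫ |ψ|²` for the wave
`ψ(x) = α e^{ikx} + β e^{ik(L-x)}` on an edge of length `L`. -/
theorem edge_inequality {k : ℂ} {L : ℝ} (hκ : 0 < k.re) (hy : 0 ≤ k.im) (hL : 0 ≤ L)
    (w : ℂ) (hw : w = Complex.exp (Complex.I * k * (L : ℂ))) (α β : ℂ) :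
    2 * k.im * Real.exp (-(k.im * L)) * (L - |Real.sin (k.re * L)| / k.re)
        * (‖α‖ ^ 2 + ‖β‖ ^ 2) ≤
      (‖α‖ ^ 2 + ‖β‖ ^ 2) - (‖w * β‖ ^ 2 + ‖w * α‖ ^ 2)
        - 2 * k.im / k.re * ((α * star (w * β)).im + (β * star (w * α)).im) := by
  -- The right-hand side of the claim is exactly 2 Im k ∫|ψ|² over the edge. It splits into (1 -
  -- r²)(|α|² + |β|²) and an interference term 4 (Im k / Re k) r sin(L Re k) Re(α β̄), which are
  -- bounded below separately.
  set r := Real.exp (-(k.im * L)) with hr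
  have hexp : Complex.I * k * (L : ℂ) = ((-(k.im * L) : ℝ) : ℂ) + ((k.re * L : ℝ) : ℂ) * Complex.I := by
    apply Complex.ext <;> simp
  have hwn : ‖w‖ = r := by
    rw [hw, Complex.norm_exp, hexp]
    simp [hr]
  have hwi : w.im = r * Real.sin (k.re * L) := by
    rw [hw, hexp, Complex.exp_im]
    simp [hr]
  have h1 : (α * star (w * β)).im + (β * star (w * α)).im = -2 * (α * star β).re * w.im := by
    simp
    ring
  have h2 : |(α * star β).re| * 2 ≤ ‖α‖ ^ 2 + ‖β‖ ^ 2 := by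
    have h3 := Complex.abs_re_le_norm (α * star β)
    rw [norm_mul, norm_star] at h3
    nlinarith [sq_nonneg (‖α‖ - ‖β‖)]
  have hr0 : 0 < r := Real.exp_pos _
  have h3 := two_mul_self_mul_exp_neg_le (mul_nonneg hy hL)
  rw [← hr] at h3
  have h4 : (α * star β).re * Real.sin (k.re * L) * 2 ≥
      -((‖α‖ ^ 2 + ‖β‖ ^ 2) * |Real.sin (k.re * L)|) := by
    have h5 := neg_abs_le ((α * star β).re * Real.sin (k.re * L))
    rw [abs_mul] at h5
    nlinarith [abs_nonneg (Real.sin (k.re * L))]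
  rw [norm_mul, norm_mul, hwn, h1, hwi]
  have h6 : 0 ≤ 2 * k.im / k.re * r := by positivity
  have h7 := mul_le_mul_of_nonneg_left h4 h6
  have h8 : 0 ≤ ‖α‖ ^ 2 + ‖β‖ ^ 2 := by positivity
  have h9 := mul_le_mul_of_nonneg_right h3 h8
  have e1 : 2 * k.im * r * (L - |Real.sin (k.re * L)| / k.re) * (‖α‖ ^ 2 + ‖β‖ ^ 2)
    = 2 * (k.im * L) * r * (‖α‖ ^ 2 + ‖β‖ ^ 2)
      + 2 * k.im / k.re * r * -((‖α‖ ^ 2 + ‖β‖ ^ 2) * |Real.sin (k.re * L)|) := by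
    ring
  rw [e1]
  nlinarith

namespace QuantumGraph

variable {V E X : Type*} [Fintype E] [Fintype X] [DecidableEq V] [DecidableEq E] [DecidableEq X]

theorem sum_edges_inequality {k : ℂ} {ℓ : E → ℝ} (hκ : 0 < k.re) (hy : 0 ≤ k.im)
    (hℓ : ∀ e, 0 ≤ ℓ e) (v : E × Bool → ℂ) :
    ∑ p : E × Bool, 2 * k.im * Real.exp (-(k.im * ℓ p.1)) *
        (ℓ p.1 - |Real.sin (k.re * ℓ p.1)| / k.re) * ‖v p‖ ^ 2 ≤
      ∑ p, ‖v p‖ ^ 2 - ∑ p, ‖incoming ℓ k v p‖ ^ 2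
        - 2 * k.im / k.re * ∑ p, (v p * star (incoming ℓ k v p)).im := by
  rw [Finset.mul_sum, ← Finset.sum_sub_distrib, ← Finset.sum_sub_distrib, Fintype.sum_prod_type,
    Fintype.sum_prod_type]
  refine Finset.sum_le_sum fun e _ => ?_
  rw [Fintype.sum_bool, Fintype.sum_bool]
  have := edge_inequality hκ hy (hℓ e) _ rfl (v (e, true)) (v (e, false))
  simp only [incoming, rev, Bool.not_true, Bool.not_false]
  linarith

/-- Dividing the flux identity by `Re k` shows that 2 Im k ∫|ψ|² over the internal edges equals
-Σ|b|², hence is nonpositive. The edge estimate bounds the same quantity below by a positive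
multiple of each |v p|². -/
theorem eq_zero_of_mulVec_eq_of_im_pos (G : QuantumGraph V E X) {ℓ : E → ℝ} (hℓ : ∀ e, 0 < ℓ e)
    {k : ℂ} (hκ : 0 < k.re) (hy : 0 < k.im) {v : E × Bool → ℂ}
    (hv : (G.scattering k * phases ℓ k).mulVec v = v) : v = 0 := by
  obtain ⟨b, hb⟩ := (G.scattering_mulVec_eq_iff ℓ hκ v v).mp hv
  have h1 := hb.flux
  have h2 := sum_edges_inequality hκ hy.le (fun e => (hℓ e).le) v
  have h3 : 0 ≤ ∑ x, ‖b x‖ ^ 2 := by positivity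
  have h4 : ∑ p, ‖v p‖ ^ 2 - ∑ p, ‖incoming ℓ k v p‖ ^ 2
        - 2 * k.im / k.re * ∑ p, (v p * star (incoming ℓ k v p)).im ≤ 0 := by
    have : k.re * (∑ p, ‖v p‖ ^ 2 - ∑ p, ‖incoming ℓ k v p‖ ^ 2
        - 2 * k.im / k.re * ∑ p, (v p * star (incoming ℓ k v p)).im) ≤ 0 := by
      have e1 : k.re * (2 * k.im / k.re * ∑ p, (v p * star (incoming ℓ k v p)).im)
          = 2 * k.im * ∑ p, (v p * star (incoming ℓ k v p)).im := by
        field_simp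
      rw [mul_sub, e1]
      nlinarith
    by_contra hc
    push Not at hc
    nlinarith
  have hpos : ∀ p : E × Bool, 0 < 2 * k.im * Real.exp (-(k.im * ℓ p.1)) *
        (ℓ p.1 - |Real.sin (k.re * ℓ p.1)| / k.re) := fun p =>
    mul_pos (by positivity) (edge_gap_pos hκ (hℓ _))
  have h5 := (Finset.sum_eq_zero_iff_of_nonneg (fun p _ =>
    mul_nonneg (hpos p).le (sq_nonneg ‖v p‖))).mp
    (le_antisymm (h2.trans h4) (Finset.sum_nonneg fun p _ =>
      mul_nonneg (hpos p).le (sq_nonneg ‖v p‖)))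
  funext p
  have h6 := h5 p (Finset.mem_univ _)
  simpa [(hpos p).ne'] using h6

theorem norm_incoming_le {ℓ : E → ℝ} (hℓ : ∀ e, 0 ≤ ℓ e) {k : ℂ} (hy : 0 ≤ k.im)
    (v : E × Bool → ℂ) (p : E × Bool) : ‖incoming ℓ k v p‖ ≤ ‖v‖ := by
  rw [incoming, norm_mul, Complex.norm_exp]
  refine (mul_le_of_le_one_left (norm_nonneg _) ?_).trans (norm_le_pi_norm v _)
  rw [Real.exp_le_one_iff]
  simp
  exact mul_nonneg hy (hℓ _)

/-- The resolvent estimate for `I - S D` in the upper half-plane. -/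
theorem exists_resolvent_bound (G : QuantumGraph V E X) {ℓ : E → ℝ} (hℓ : ∀ e, 0 < ℓ e)
    {κ : ℝ} (hκ : 0 < κ) :
    ∃ C : ℝ, ∀ y : ℝ, 0 < y → y ≤ 1 → ∀ v : E × Bool → ℂ,
      y * ‖v‖ ≤ C * ‖(1 - G.scattering (κ + y * Complex.I) *
        phases ℓ (κ + y * Complex.I)).mulVec v‖ := by
  -- A common lower bound for the edge coefficients, divided by y: for y ≤ 1 the factor e^{-yℓ} is
  -- at least e^{-ℓ}.
  obtain ⟨c, hc, hce⟩ : ∃ c : ℝ, 0 < c ∧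
      ∀ e, c ≤ 2 * Real.exp (-ℓ e) * (ℓ e - |Real.sin (κ * ℓ e)| / κ) := by
    have h1 : ∀ᶠ c in 𝓝[>] (0 : ℝ),
        ∀ e, c ≤ 2 * Real.exp (-ℓ e) * (ℓ e - |Real.sin (κ * ℓ e)| / κ) := by
      rw [eventually_all]
      intro e
      refine nhdsWithin_le_nhds (eventually_le_nhds ?_)
      exact mul_pos (by positivity) (edge_gap_pos hκ (hℓ e))
    exact (eventually_mem_nhdsWithin.and h1).exists
  set N : ℝ := (Fintype.card (E × Bool) : ℝ)
  refine ⟨N * (2 + 2 / κ) / c, fun y hy hy1 v => ?_⟩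
  set k : ℂ := κ + y * Complex.I with hk
  have hkre : k.re = κ := by simp [hk]
  have hkim : k.im = y := by simp [hk]
  set v' := (G.scattering k * phases ℓ k).mulVec v with hv'
  set d := (1 - G.scattering k * phases ℓ k).mulVec v with hd
  have hd' : ∀ p, v' p = v p - d p := fun p => by
    rw [hd, Matrix.sub_mulVec, Matrix.one_mulVec, ← hv']
    simp
  obtain ⟨b, hb⟩ := (G.scattering_mulVec_eq_iff ℓ (by rw [hkre]; exact hκ) v v').mp hv'.symm
  have h1 := hb.flux
  have h2 := sum_edges_inequality (k := k) (by rw [hkre]; exact hκ) (by rw [hkim]; exact hy.le)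
    (fun e => (hℓ e).le) v
  rw [hkre, hkim] at h1 h2
  set u := incoming ℓ k v with hu
  have h3 : 0 ≤ ∑ x, ‖b x‖ ^ 2 := by positivity
  -- Flux controls the energy form at the outgoing amplitudes `v'`, whereas the edge estimate bounds
  -- it from below at `v`. Below, the two values are compared through v = v' + d.
  have h4 : ∑ p, ‖v' p‖ ^ 2 - ∑ p, ‖u p‖ ^ 2 - 2 * y / κ * ∑ p, (v' p * star (u p)).im ≤ 0 := by
    have : κ * (∑ p, ‖v' p‖ ^ 2 - ∑ p, ‖u p‖ ^ 2 - 2 * y / κ * ∑ p, (v' p * star (u p)).im)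
        ≤ 0 := by
      have e1 : κ * (2 * y / κ * ∑ p, (v' p * star (u p)).im)
          = 2 * y * ∑ p, (v' p * star (u p)).im := by
        field_simp
      rw [mul_sub, e1]
      nlinarith
    by_contra hcon
    push Not at hcon
    nlinarith
  have h5 : c * y * ‖v‖ ^ 2 ≤ ∑ p : E × Bool, 2 * y * Real.exp (-(y * ℓ p.1)) *
        (ℓ p.1 - |Real.sin (κ * ℓ p.1)| / κ) * ‖v p‖ ^ 2 := by
    have h6 : c * y * ∑ p, ‖v p‖ ^ 2 ≤ ∑ p : E × Bool, 2 * y * Real.exp (-(y * ℓ p.1)) *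
        (ℓ p.1 - |Real.sin (κ * ℓ p.1)| / κ) * ‖v p‖ ^ 2 := by
      rw [Finset.mul_sum]
      refine Finset.sum_le_sum fun p _ => mul_le_mul_of_nonneg_right ?_ (sq_nonneg _)
      have h7 : Real.exp (-ℓ p.1) ≤ Real.exp (-(y * ℓ p.1)) :=
        Real.exp_le_exp.mpr (by nlinarith [hℓ p.1])
      have h8 := edge_gap_pos hκ (hℓ p.1)
      calc c * y ≤ (2 * Real.exp (-ℓ p.1) * (ℓ p.1 - |Real.sin (κ * ℓ p.1)| / κ)) * y :=
            mul_le_mul_of_nonneg_right (hce _) hy.le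
        _ ≤ (2 * Real.exp (-(y * ℓ p.1)) * (ℓ p.1 - |Real.sin (κ * ℓ p.1)| / κ)) * y := by
            gcongr
        _ = _ := by ring
    refine le_trans (mul_le_mul_of_nonneg_left ?_ (by positivity)) h6
    have h9 : ‖v‖ ≤ Real.sqrt (∑ p, ‖v p‖ ^ 2) := by
      rw [pi_norm_le_iff_of_nonneg (Real.sqrt_nonneg _)]
      intro p
      refine Real.le_sqrt_of_sq_le ?_
      exact Finset.single_le_sum (f := fun p => ‖v p‖ ^ 2) (fun _ _ => sq_nonneg _)
        (Finset.mem_univ p)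
    calc ‖v‖ ^ 2 ≤ Real.sqrt (∑ p, ‖v p‖ ^ 2) ^ 2 := by gcongr
      _ = _ := Real.sq_sqrt (by positivity)
  -- The replacement costs only O(‖v‖ ‖d‖), so one factor ‖v‖ can be cancelled at the end.
  have h6 : (∑ p, ‖v p‖ ^ 2 - ∑ p, ‖u p‖ ^ 2 - 2 * y / κ * ∑ p, (v p * star (u p)).im)
      - (∑ p, ‖v' p‖ ^ 2 - ∑ p, ‖u p‖ ^ 2 - 2 * y / κ * ∑ p, (v' p * star (u p)).im)
      ≤ N * ((2 + 2 / κ) * (‖v‖ * ‖d‖)) := by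
    have e1 : (∑ p, ‖v p‖ ^ 2 - ∑ p, ‖u p‖ ^ 2 - 2 * y / κ * ∑ p, (v p * star (u p)).im)
      - (∑ p, ‖v' p‖ ^ 2 - ∑ p, ‖u p‖ ^ 2 - 2 * y / κ * ∑ p, (v' p * star (u p)).im)
      = ∑ p, (‖v p‖ ^ 2 - ‖v' p‖ ^ 2 - 2 * y / κ * (d p * star (u p)).im) := by
      simp only [hd', Finset.sum_sub_distrib, sub_mul, Complex.sub_im, ← Finset.mul_sum, mul_sub]
      ring
    rw [e1]
    have e2 : ∑ _p : E × Bool, (2 + 2 / κ) * (‖v‖ * ‖d‖) = N * ((2 + 2 / κ) * (‖v‖ * ‖d‖)) := by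
      rw [Finset.sum_const, Finset.card_univ, nsmul_eq_mul]
    rw [← e2]
    refine Finset.sum_le_sum fun p _ => ?_
    have hvp := norm_le_pi_norm v p
    have hdp := norm_le_pi_norm d p
    have hup : ‖u p‖ ≤ ‖v‖ :=
      norm_incoming_le (fun e => (hℓ e).le) (by rw [hkim]; exact hy.le) v p
    have h7 : ‖v p‖ ^ 2 - ‖v' p‖ ^ 2 ≤ 2 * (‖v‖ * ‖d‖) := by
      have h8 : ‖v p‖ ≤ ‖v' p‖ + ‖d p‖ := by
        calc ‖v p‖ = ‖v' p + d p‖ := by rw [hd', sub_add_cancel]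
          _ ≤ _ := norm_add_le _ _
      have h9 : ‖v p‖ * ‖d p‖ ≤ ‖v‖ * ‖d‖ := by gcongr
      nlinarith [sq_nonneg (‖v p‖ - ‖v' p‖), mul_le_mul_of_nonneg_left h8 (norm_nonneg (v p))]
    have h10 : -(2 * y / κ * (d p * star (u p)).im) ≤ 2 / κ * (‖v‖ * ‖d‖) := by
      have h11 : -(d p * star (u p)).im ≤ ‖v‖ * ‖d‖ := by
        refine (neg_le_abs _).trans ((Complex.abs_im_le_norm _).trans ?_)
        rw [norm_mul, norm_star, mul_comm]
        gcongr
      calc -(2 * y / κ * (d p * star (u p)).im) = (2 * y / κ) * -(d p * star (u p)).im := by ring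
        _ ≤ (2 * y / κ) * (‖v‖ * ‖d‖) := by gcongr
        _ ≤ 2 / κ * (‖v‖ * ‖d‖) := by
            gcongr
            linarith
    linarith
  have h7 : c * y * ‖v‖ ^ 2 ≤ N * ((2 + 2 / κ) * (‖v‖ * ‖d‖)) := by linarith
  rcases (norm_nonneg v).eq_or_lt with h8 | h8
  · rw [← h8, mul_zero]
    positivity
  · rw [div_mul_eq_mul_div, le_div_iff₀ hc]
    nlinarith

end QuantumGraph

/-! ### From a resolvent bound to a simple zero of the determinant -/

section SimpleZero

variable {B : Type*} [Fintype B] [DecidableEq B]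

/-- If the kernel of `N k₀` is at most one-dimensional, and `‖(N k)⁻¹‖` grows at most like
`1 / |k - k₀|` in the upper half-plane, then a zero of `det N` at `k₀` is simple. -/
theorem deriv_det_ne_zero_of_resolvent_bound {N : ℂ → Matrix B B ℂ} {k₀ : ℂ} {C : ℝ}
    (hN : AnalyticEntries N k₀) (hdet : (N k₀).det = 0) {u₀ : B → ℂ}
    (hker : ∀ v, (N k₀).mulVec v = 0 → ∃ c : ℂ, v = c • u₀)
    (hbound : ∀ y : ℝ, 0 < y → y ≤ 1 → ∀ v : B → ℂ,
      y * ‖v‖ ≤ C * ‖(N (k₀ + y * Complex.I)).mulVec v‖) :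
    deriv (fun k => (N k).det) k₀ ≠ 0 := by
  intro hderiv
  have hF : HasDerivAt (fun k => (N k).det) 0 k₀ := by
    rw [← hderiv]
    exact hN.det.differentiableAt.hasDerivAt
  obtain ⟨p, hp⟩ : ∃ p, ∀ v, (N k₀).mulVec v ≠ p := by
    by_contra hc
    push Not at hc
    have h1 := Matrix.mulVec_surjective_iff_isUnit.mp hc
    rw [Matrix.isUnit_iff_isUnit_det, hdet] at h1
    exact not_isUnit_zero h1
  have hp0 : p ≠ 0 := fun h => hp 0 (by rw [h, Matrix.mulVec_zero])
  obtain ⟨u, hu, hu0⟩ := Matrix.exists_mulVec_eq_zero_iff.mpr hdet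
  obtain ⟨i, hi⟩ : ∃ i, u₀ i ≠ 0 := by
    obtain ⟨c, rfl⟩ := hker u hu0
    exact Function.ne_iff.mp (right_ne_zero_of_smul hu)
  set q : B → ℂ := Pi.single i 1 with hq
  have hqv : ∀ v : B → ℂ, q ⬝ᵥ v = v i := fun v => by simp [hq]
  -- A rank-one perturbation that is invertible at k₀: `p` lies outside the range of N k₀, and the
  -- coordinate functional `q` does not vanish on the kernel.
  set D : ℂ → Matrix B B ℂ := fun k => N k - -Matrix.vecMulVec p q with hD
  have hDv : ∀ k v, (D k).mulVec v = (N k).mulVec v + v i • p := by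
    intro k v
    rw [hD]
    simp only [sub_neg_eq_add, Matrix.add_mulVec, Matrix.vecMulVec_mulVec, hqv]
    simp
  have hDan : AnalyticEntries D k₀ := hN.sub (.const _ _)
  have hD0 : IsUnit (D k₀).det := by
    rw [isUnit_iff_ne_zero]
    intro h0
    obtain ⟨v, hv, hv0⟩ := Matrix.exists_mulVec_eq_zero_iff.mpr h0
    rw [hDv] at hv0
    have hvi : v i = 0 := by
      by_contra hvi
      refine hp (-(v i)⁻¹ • v) ?_
      rw [Matrix.mulVec_smul, eq_neg_of_add_eq_zero_left hv0, smul_neg, neg_smul, neg_neg, smul_smul,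
        inv_mul_cancel₀ hvi, one_smul]
    rw [hvi, zero_smul, add_zero] at hv0
    obtain ⟨c, rfl⟩ := hker v hv0
    have : c = 0 := by simpa [hi] using hvi
    exact hv (by rw [this, zero_smul])
  set x : ℂ → B → ℂ := fun k => (D k)⁻¹.mulVec p with hx
  have hxc : ContinuousAt x k₀ := by
    refine continuousAt_pi.mpr fun j => ?_
    simp only [hx, Matrix.mulVec, dotProduct]
    exact (Finset.analyticAt_fun_sum Finset.univ fun a _ =>
      ((hDan.inv hD0) j a).mul analyticAt_const).continuousAt
  have hDx : ∀ k, IsUnit (D k).det → (D k).mulVec (x k) = p := by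
    intro k hk
    rw [hx]
    simp only [Matrix.mulVec_mulVec]
    rw [Matrix.mul_nonsing_inv _ hk, Matrix.one_mulVec]
  have hx0 : x k₀ ≠ 0 := by
    intro h
    have := hDx k₀ hD0
    rw [h, Matrix.mulVec_zero] at this
    exact hp0 this.symm
  -- From D x = p one gets N x = (1 - x i) p, and the matrix determinant lemma identifies 1 - x i
  -- with det N / det D. So the image of `x` is as small as det N, while `x` itself stays away from
  -- zero.
  have hNx : ∀ k, IsUnit (D k).det → (N k).mulVec (x k) = ((N k).det / (D k).det) • p := by
    intro k hk
    have h1 := hDx k hk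
    rw [hDv] at h1
    have h2 : N k = D k + Matrix.replicateCol Unit (-p) * Matrix.replicateRow Unit q := by
      rw [hD]
      ext a b
      simp [Matrix.vecMulVec_apply, Matrix.mul_apply]
    have h3 : (N k).det = (D k).det * (1 - x k i) := by
      rw [h2, Matrix.det_add_replicateCol_mul_replicateRow hk]
      congr 1
      simp [Matrix.mul_apply, hx, Matrix.mulVec, dotProduct, hq, Matrix.replicateRow_apply,
        Pi.single_apply, sub_eq_add_neg]
    rw [h3, mul_div_cancel_left₀ _ hk.ne_zero, sub_smul, one_smul, eq_sub_iff_add_eq]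
    exact h1
  have hpath : Tendsto (fun y : ℝ => k₀ + y * Complex.I) (𝓝[>] 0) (𝓝 k₀) := by
    have h1 : Continuous fun y : ℝ => k₀ + y * Complex.I := by fun_prop
    have h2 := h1.tendsto 0
    simp only [Complex.ofReal_zero, zero_mul, add_zero] at h2
    exact h2.mono_left nhdsWithin_le_nhds
  -- This is where the assumed double zero enters: the determinant is o(y) along the vertical ray,
  -- and the bound then forces x k₀ = 0.
  have hlim : Tendsto (fun y : ℝ => (N (k₀ + y * Complex.I)).det / y) (𝓝[>] 0) (𝓝 0) := by
    have h1 : HasDerivAt (fun y : ℝ => (N (k₀ + y * Complex.I)).det) 0 0 := by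
      have h2 : HasDerivAt (fun y : ℝ => k₀ + y * Complex.I) Complex.I 0 := by
        have := (Complex.ofRealCLM.hasDerivAt (x := 0)).mul_const Complex.I
        simpa using this.const_add k₀
      have h3 : HasDerivAt (fun k => (N k).det) 0 (k₀ + ((0 : ℝ) : ℂ) * Complex.I) := by
        simpa using hF
      have := h3.comp (0 : ℝ) h2
      rwa [zero_mul] at this
    have h2 := h1.tendsto_slope_zero_right
    simp only [zero_add, Complex.ofReal_zero, zero_mul, add_zero, hdet, sub_zero] at h2
    refine h2.congr fun y => ?_
    rw [Complex.real_smul, Complex.ofReal_inv, div_eq_inv_mul]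
  have hDev : ∀ᶠ y : ℝ in 𝓝[>] 0, IsUnit (D (k₀ + y * Complex.I)).det := by
    have h1 := (hDan.det.continuousAt.tendsto.comp hpath).eventually_ne hD0.ne_zero
    exact h1.mono fun y hy => isUnit_iff_ne_zero.mpr hy
  have hle : ∀ᶠ y : ℝ in 𝓝[>] 0, ‖x (k₀ + y * Complex.I)‖ ≤
      C * (‖(N (k₀ + y * Complex.I)).det / y‖ / ‖(D (k₀ + y * Complex.I)).det‖ * ‖p‖) := by
    filter_upwards [hDev, self_mem_nhdsWithin,
      nhdsWithin_le_nhds (eventually_le_nhds (zero_lt_one' ℝ))] with y h1 (h2 : 0 < y) h3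
    have h4 := hbound y h2 h3 (x (k₀ + y * Complex.I))
    rw [hNx _ h1, norm_smul, norm_div] at h4
    rw [norm_div, Complex.norm_real, Real.norm_of_nonneg h2.le]
    rw [← le_div_iff₀' h2] at h4
    refine h4.trans (le_of_eq ?_)
    ring
  have h1 := le_of_tendsto_of_tendsto (hxc.tendsto.comp hpath).norm
    (((hlim.norm.div (hDan.det.continuousAt.tendsto.comp hpath).norm
      (norm_ne_zero_iff.mpr hD0.ne_zero)).mul_const ‖p‖).const_mul C) hle
  simp only [norm_zero, zero_div, zero_mul, mul_zero] at h1
  exact hx0 (norm_le_zero_iff.mp h1)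

end SimpleZero

/-! ### Solutions of -f'' = k² f on edges and leads -/

section EdgeWaves

theorem eq_mul_exp_of_hasDerivWithinAt {s : Set ℝ} (hs : Convex ℝ s) (h0 : (0 : ℝ) ∈ s) {c : ℂ}
    {g : ℝ → ℂ} (hg : ∀ x ∈ s, HasDerivWithinAt g (c * g x) s x) {x : ℝ} (hx : x ∈ s) :
    g x = g 0 * Complex.exp (c * x) := by
  have hexp : ∀ y : ℝ, HasDerivAt (fun y : ℝ => Complex.exp (-(c * y)))
      (Complex.exp (-(c * y)) * -c) y := by
    intro y
    have h1 : HasDerivAt (fun y : ℝ => -(c * (y : ℂ))) (-c) y := by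
      simpa using ((Complex.ofRealCLM.hasDerivAt (x := y)).const_mul c).fun_neg
    exact h1.cexp
  have h1 := hs.norm_image_sub_le_of_norm_hasDerivWithin_le
    (f := fun y : ℝ => g y * Complex.exp (-(c * y))) (f' := fun _ => 0) (C := 0)
    (fun y hy => ((hg y hy).mul (hexp y).hasDerivWithinAt).congr_deriv (by ring))
    (fun y _ => by simp) h0 hx
  simp only [zero_mul, norm_le_zero_iff, sub_eq_zero] at h1
  simp only [Complex.ofReal_zero, mul_zero, neg_zero, Complex.exp_zero, mul_one] at h1
  rw [← h1, mul_assoc, ← Complex.exp_add]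
  simp

/-- A Sobolev solution of `-f'' = z f` on an interval is a classical solution. -/
theorem HasSecondSobolevDeriv.hasDerivWithinAt_derivWithin {s : Set ℝ} {f h : ℝ → ℂ} {z : ℂ}
    (hf : HasSecondSobolevDeriv s f h) (hz : ∀ᵐ x ∂volume.restrict s, -h x = z * f x)
    (hs : Convex ℝ s) (hms : MeasurableSet s) (h0 : (0 : ℝ) ∈ s) (hnn : ∀ x ∈ s, 0 ≤ x)
    {r : ℝ → ℝ} (hr : Continuous r) (hrs : ∀ x, r x ∈ s) (hrx : ∀ x ∈ s, r x = x)
    {x : ℝ} (hx : x ∈ s) :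
    HasDerivWithinAt (derivWithin f s) (-(z * f x)) s x := by
  -- Composing with the retraction `r` of ℝ onto `s` makes the integrand continuous on ℝ, so the
  -- fundamental theorem of calculus applies at every point, endpoints included.
  have hc : Continuous fun y => -(z * f (r y)) :=
    (continuous_const.mul (hf.differentiableOn.continuousOn.comp_continuous hr hrs)).neg
  have h1 : ∀ y ∈ s, derivWithin f s y
      = derivWithin f s 0 + ∫ t in (0 : ℝ)..y, -(z * f (r t)) := by
    intro y hy
    rw [hf.deriv_eq y hy]
    congr 1
    refine intervalIntegral.integral_congr_ae ?_
    rw [ae_restrict_iff' hms] at hz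
    filter_upwards [hz] with t ht hty
    rw [uIoc_of_le (hnn y hy)] at hty
    have hts : t ∈ s := hs.ordConnected.out h0 hy ⟨hty.1.le, hty.2⟩
    rw [hrx t hts, ← ht hts, neg_neg]
  have h2 : HasDerivAt (fun y => derivWithin f s 0 + ∫ t in (0 : ℝ)..y, -(z * f (r t)))
      (-(z * f (r x))) x :=
    (hc.integral_hasStrictDerivAt 0 x).hasDerivAt.const_add _
  rw [hrx x hx] at h2
  exact h2.hasDerivWithinAt.congr h1 (h1 x hx)

/-- On an interval, a Sobolev solution of `-f'' = k² f` consists of two exponentials. -/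
theorem HasSecondSobolevDeriv.deriv_add_eq_mul_exp {s : Set ℝ} {f h : ℝ → ℂ} {k : ℂ}
    (hf : HasSecondSobolevDeriv s f h) (hz : ∀ᵐ x ∂volume.restrict s, -h x = k ^ 2 * f x)
    (hs : Convex ℝ s) (hms : MeasurableSet s) (h0 : (0 : ℝ) ∈ s) (hnn : ∀ x ∈ s, 0 ≤ x)
    {r : ℝ → ℝ} (hr : Continuous r) (hrs : ∀ x, r x ∈ s) (hrx : ∀ x ∈ s, r x = x)
    {x : ℝ} (hx : x ∈ s) :
    derivWithin f s x + Complex.I * k * f x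
      = (derivWithin f s 0 + Complex.I * k * f 0) * Complex.exp (Complex.I * k * x) := by
  -- The factorization of d²/dx² + k²: g = f' + ikf satisfies the first-order equation g' = ikg.
  refine eq_mul_exp_of_hasDerivWithinAt hs h0
    (g := fun x => derivWithin f s x + Complex.I * k * f x) (fun y hy => ?_) hx
  refine ((hf.hasDerivWithinAt_derivWithin hz hs hms h0 hnn hr hrs hrx hy).add
    ((hf.differentiableOn y hy).hasDerivWithinAt.const_mul (Complex.I * k))).congr_deriv ?_
  linear_combination (k ^ 2 * f y) * -Complex.I_sq

/-- The wave `α e^{ikx} + β e^{ik(L-x)}`. -/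
noncomputable def edgeWave (k : ℂ) (L : ℝ) (α β : ℂ) (x : ℝ) : ℂ :=
  α * Complex.exp (Complex.I * k * x) + β * Complex.exp (Complex.I * k * (L - x))

theorem hasDerivAt_exp_I_mul (k : ℂ) (x : ℝ) :
    HasDerivAt (fun y : ℝ => Complex.exp (Complex.I * k * y))
      (Complex.I * k * Complex.exp (Complex.I * k * x)) x := by
  have h1 : HasDerivAt (fun y : ℝ => Complex.I * k * (y : ℂ)) (Complex.I * k) x := by
    simpa using (Complex.ofRealCLM.hasDerivAt (x := x)).const_mul (Complex.I * k)
  simpa [mul_comm] using h1.cexp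

theorem hasDerivAt_edgeWave (k : ℂ) (L : ℝ) (α β : ℂ) (x : ℝ) :
    HasDerivAt (edgeWave k L α β) (Complex.I * k * edgeWave k L α (-β) x) x := by
  have h1 : HasDerivAt (fun y : ℝ => Complex.I * k * ((L : ℂ) - (y : ℂ))) (Complex.I * k * -1) x :=
    ((Complex.ofRealCLM.hasDerivAt (x := x)).const_sub (L : ℂ)).const_mul (Complex.I * k)
  refine (((hasDerivAt_exp_I_mul k x).const_mul α).add (h1.cexp.const_mul β)).congr_deriv ?_
  rw [edgeWave]
  ring

theorem derivWithin_of_eqOn {s : Set ℝ} {f g : ℝ → ℂ} {g' : ℂ} {x : ℝ} (hs : UniqueDiffOn ℝ s)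
    (hfg : ∀ y ∈ s, f y = g y) (hx : x ∈ s) (hg : HasDerivAt g g' x) :
    derivWithin f s x = g' :=
  ((hg.hasDerivWithinAt).congr hfg (hfg x hx)).derivWithin (hs x hx)

theorem edgeWave_zero_left (k : ℂ) (L : ℝ) (α β : ℂ) :
    edgeWave k L α β 0 = α + Complex.exp (Complex.I * k * L) * β := by
  simp [edgeWave, mul_comm]

theorem edgeWave_right (k : ℂ) (L : ℝ) (α β : ℂ) :
    edgeWave k L α β L = Complex.exp (Complex.I * k * L) * α + β := by
  simp [edgeWave, mul_comm]

theorem edgeWave_eq_zero {k : ℂ} (hk : k ≠ 0) {L : ℝ} (hL : 0 < L) {α β : ℂ}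
    (h : ∀ x ∈ Icc 0 L, edgeWave k L α β x = 0) : α = 0 ∧ β = 0 := by
  have h0 : (0 : ℝ) ∈ Icc 0 L := ⟨le_rfl, hL.le⟩
  have h1 := h 0 h0
  have h2 := derivWithin_of_eqOn (uniqueDiffOn_Icc hL) (fun y hy => (h y hy).symm) h0
    (hasDerivAt_edgeWave k L α β 0)
  rw [derivWithin_fun_const] at h2
  have h3 : edgeWave k L α (-β) 0 = 0 := by
    simpa [Complex.I_ne_zero, hk] using h2.symm
  rw [edgeWave_zero_left] at h1 h3
  have hα : α = 0 := by linear_combination (h1 + h3) / 2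
  refine ⟨hα, ?_⟩
  rw [hα, zero_add] at h1
  exact (mul_eq_zero.mp h1).resolve_left (Complex.exp_ne_zero _)

theorem HasSecondSobolevDeriv.exists_eq_edgeWave {L : ℝ} (hL : 0 < L) {f h : ℝ → ℂ} {k : ℂ}
    (hk : k ≠ 0) (hf : HasSecondSobolevDeriv (Icc 0 L) f h)
    (hz : ∀ᵐ x ∂volume.restrict (Icc 0 L), -h x = k ^ 2 * f x) :
    ∃ α β, ∀ x ∈ Icc 0 L, f x = edgeWave k L α β x := by
  have key : ∀ c : ℂ, c ^ 2 = k ^ 2 → ∀ x ∈ Icc 0 L, derivWithin f (Icc 0 L) x + Complex.I * c * f x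
      = (derivWithin f (Icc 0 L) 0 + Complex.I * c * f 0) * Complex.exp (Complex.I * c * x) :=
    fun c hc x hx => hf.deriv_add_eq_mul_exp (by rwa [hc]) (convex_Icc 0 L) measurableSet_Icc
      ⟨le_rfl, hL.le⟩ (fun x hx => hx.1) (r := fun x => max 0 (min x L)) (by fun_prop)
      (fun x => ⟨le_max_left _ _, max_le hL.le (min_le_right _ _)⟩)
      (fun x hx => by rw [min_eq_left hx.2, max_eq_right hx.1]) hx
  set f0 := derivWithin f (Icc 0 L) 0
  -- The difference of the identities for k and -k is 2ikf. The factor e^{-ikL} in β compensates for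
  -- the normalization e^{ik(L-x)} of the backward wave.
  refine ⟨(f0 + Complex.I * k * f 0) / (2 * Complex.I * k),
    -(f0 - Complex.I * k * f 0) / (2 * Complex.I * k) * Complex.exp (-(Complex.I * k * L)),
    fun x hx => ?_⟩
  have h1 := key k rfl x hx
  have h2 := key (-k) (by ring) x hx
  have h3 : Complex.exp (-(Complex.I * k * L)) * Complex.exp (Complex.I * k * (L - x))
      = Complex.exp (Complex.I * -k * x) := by
    rw [← Complex.exp_add]
    ring_nf
  have hk2 : 2 * Complex.I * k ≠ 0 := by simp [hk, Complex.I_ne_zero]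
  rw [edgeWave, mul_assoc (-(f0 - Complex.I * k * f 0) / (2 * Complex.I * k)), h3]
  generalize Complex.exp (Complex.I * -k * x) = e₂ at h2 ⊢
  field_simp
  linear_combination h1 - h2

/-- For real κ both f' + iκf and f' - iκf have constant modulus. A constant is square integrable on
a half-line only if it is zero. -/
theorem HasSecondSobolevDeriv.eq_zero_on_lead {f h : ℝ → ℂ} {κ : ℝ} (hκ : κ ≠ 0)
    (hf : HasSecondSobolevDeriv (Ici 0) f h)
    (hz : ∀ᵐ x ∂volume.restrict (Ici (0 : ℝ)), -h x = (κ : ℂ) ^ 2 * f x) :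
    ∀ x ∈ Ici (0 : ℝ), f x = 0 := by
  have key : ∀ c : ℝ, (c : ℂ) ^ 2 = (κ : ℂ) ^ 2 → ∀ x ∈ Ici (0 : ℝ),
      derivWithin f (Ici 0) x + Complex.I * c * f x = 0 := by
    intro c hc x hx
    have h1 : ∀ x ∈ Ici (0 : ℝ), derivWithin f (Ici 0) x + Complex.I * c * f x
        = (derivWithin f (Ici 0) 0 + Complex.I * c * f 0) * Complex.exp (Complex.I * c * x) :=
      fun x hx => hf.deriv_add_eq_mul_exp (by rwa [hc]) (convex_Ici 0) measurableSet_Ici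
        self_mem_Ici (fun x hx => hx) (r := fun x => max 0 x) (by fun_prop)
        (fun x => mem_Ici.mpr (le_max_left _ _)) (fun x hx => max_eq_right hx) hx
    set A := derivWithin f (Ici 0) 0 + Complex.I * c * f 0
    have h2 : MemLp (fun x => derivWithin f (Ici 0) x + Complex.I * c * f x) 2
        (volume.restrict (Ici (0 : ℝ))) := hf.memLp_deriv.add (hf.memLp.const_mul _)
    have h3 : MemLp (fun _ : ℝ => ‖A‖) 2 (volume.restrict (Ici (0 : ℝ))) := by
      refine (memLp_congr_ae ?_).mp h2.norm
      refine (ae_restrict_iff' measurableSet_Ici).mpr (Eventually.of_forall fun x hx => ?_)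
      simp only [h1 x hx, norm_mul, Complex.norm_exp]
      simp
    rw [memLp_const_iff (by norm_num) (by norm_num)] at h3
    simp only [Measure.restrict_apply MeasurableSet.univ, univ_inter, Real.volume_Ici, lt_self_iff_false,
      or_false, norm_eq_zero] at h3
    rw [h1 x hx, h3, zero_mul]
  intro x hx
  have h1 := key κ rfl x hx
  have h2 := key (-κ) (by push_cast; ring) x hx
  push_cast at h2
  have h3 : Complex.I * κ * f x = 0 := by linear_combination (h1 - h2) / 2
  simpa [hκ, Complex.I_ne_zero] using h3

theorem HasSecondSobolevDeriv.of_hasDerivAt {L : ℝ} (hL : 0 < L) {f g h : ℝ → ℂ}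
    (hf : ∀ x, HasDerivAt f (g x) x) (hg : ∀ x, HasDerivAt g (h x) x) (hh : Continuous h) :
    HasSecondSobolevDeriv (Icc 0 L) f h := by
  have hfc : Continuous f := continuous_iff_continuousAt.mpr fun x => (hf x).continuousAt
  have hgc : Continuous g := continuous_iff_continuousAt.mpr fun x => (hg x).continuousAt
  have hmem : ∀ φ : ℝ → ℂ, Continuous φ → MemLp φ 2 (volume.restrict (Icc 0 L)) := by
    intro φ hφ
    obtain ⟨C, hC⟩ := isCompact_Icc.exists_bound_of_continuousOn (hφ.continuousOn (s := Icc 0 L))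
    exact MemLp.of_bound hφ.aestronglyMeasurable C
      ((ae_restrict_iff' measurableSet_Icc).mpr (Eventually.of_forall hC))
  have hd : ∀ x ∈ Icc 0 L, derivWithin f (Icc 0 L) x = g x := fun x hx =>
    derivWithin_of_eqOn (uniqueDiffOn_Icc hL) (fun _ _ => rfl) hx (hf x)
  refine ⟨hmem f hfc, (memLp_congr_ae ?_).mpr (hmem g hgc), hmem h hh,
    fun x _ => (hf x).differentiableAt.differentiableWithinAt, fun x hx => ?_⟩
  · exact (ae_restrict_iff' measurableSet_Icc).mpr (Eventually.of_forall hd)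
  · rw [hd x hx, hd 0 ⟨le_rfl, hL.le⟩,
      intervalIntegral.integral_eq_sub_of_hasDerivAt (fun y _ => hg y) (hh.intervalIntegrable _ _)]
    ring

theorem hasSecondSobolevDeriv_edgeWave {L : ℝ} (hL : 0 < L) (k α β : ℂ) :
    HasSecondSobolevDeriv (Icc 0 L) (edgeWave k L α β) (fun x => -(k ^ 2 * edgeWave k L α β x)) := by
  refine .of_hasDerivAt hL (hasDerivAt_edgeWave k L α β) (fun x => ?_) ?_
  · refine ((hasDerivAt_edgeWave k L α (-β) x).const_mul (Complex.I * k)).congr_deriv ?_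
    rw [neg_neg]
    linear_combination (k ^ 2 * edgeWave k L α β x) * Complex.I_sq
  · unfold edgeWave
    fun_prop

theorem hasSecondSobolevDeriv_zero (s : Set ℝ) : HasSecondSobolevDeriv s (fun _ => 0) (fun _ => 0) where
  memLp := MemLp.zero'
  memLp_deriv := by simp
  memLp_second := MemLp.zero'
  differentiableOn := differentiableOn_const _
  deriv_eq := by simp

end EdgeWaves

/-! ### Fixed vectors of S D, eigenfunctions and resonances -/

namespace QuantumGraph

variable {V E X : Type*} [Fintype E] [Fintype X] [DecidableEq V] [DecidableEq E] [DecidableEq X]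

/-- The function on the graph with outgoing amplitudes `v` at the ends of the internal edges and
amplitudes `b` on the leads. -/
noncomputable def graphWave (ℓ : E → ℝ) (k : ℂ) (v : E × Bool → ℂ) (b : X → ℂ) :
    E ⊕ X → ℝ → ℂ :=
  Sum.elim (fun e => edgeWave k (ℓ e) (v (e, false)) (v (e, true)))
    (fun j x => b j * Complex.exp (Complex.I * k * x))

theorem coupling_iff_of_eqOn (G : QuantumGraph V E X) {ℓ : E → ℝ} (hℓ : ∀ e, 0 < ℓ e) (k : ℂ)
    (v : E × Bool → ℂ) (b : X → ℂ) {ψ : E ⊕ X → ℝ → ℂ}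
    (hψ : ∀ e, ∀ x ∈ edgeDomain ℓ e, ψ e x = graphWave ℓ k v b e x) :
    G.Coupling ℓ ψ ↔ G.AmplitudeCoupling k (incoming ℓ k v) v b := by
  have hleft : ∀ e, (0 : ℝ) ∈ Icc 0 (ℓ e) := fun e => ⟨le_rfl, (hℓ e).le⟩
  have hright : ∀ e, ℓ e ∈ Icc 0 (ℓ e) := fun e => ⟨(hℓ e).le, le_rfl⟩
  have hin : ∀ e, ∀ x ∈ Icc 0 (ℓ e), ψ (Sum.inl e) x
      = edgeWave k (ℓ e) (v (e, false)) (v (e, true)) x := fun e => hψ (Sum.inl e)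
  have hout : ∀ j, ∀ x ∈ Ici (0 : ℝ), ψ (Sum.inr j) x = b j * Complex.exp (Complex.I * k * x) :=
    fun j => hψ (Sum.inr j)
  refine forall_congr' fun w => ?_
  have h1 : G.boundaryValues ℓ ψ w
      = Sum.elim (fun p => incoming ℓ k v p.1 + v p.1) (fun x => b x.1) := by
    funext i
    rcases i with ⟨⟨e, _ | _⟩, hp⟩ | ⟨j, hj⟩
    · simp only [boundaryValues, Sum.elim_inl, incoming, rev]
      rw [if_neg (by simp), hin e 0 (hleft e), edgeWave_zero_left]
      simp [add_comm]
    · simp only [boundaryValues, Sum.elim_inl, incoming, rev]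
      rw [if_pos (by simp), hin e _ (hright e), edgeWave_right]
      simp
    · simp only [boundaryValues, Sum.elim_inr]
      rw [hout j 0 self_mem_Ici]
      simp
  have h2 : G.boundaryDerivs ℓ ψ w
      = Sum.elim (fun p => Complex.I * k * (v p.1 - incoming ℓ k v p.1))
        (fun x => Complex.I * k * b x.1) := by
    funext i
    rcases i with ⟨⟨e, _ | _⟩, hp⟩ | ⟨j, hj⟩
    · simp only [boundaryDerivs, Sum.elim_inl, incoming, rev]
      rw [if_neg (by simp), derivWithin_of_eqOn (uniqueDiffOn_Icc (hℓ e)) (hin e) (hleft e)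
        (hasDerivAt_edgeWave _ _ _ _ _), edgeWave_zero_left]
      simp only [Bool.not_false]
      ring
    · simp only [boundaryDerivs, Sum.elim_inl, incoming, rev]
      rw [if_pos (by simp), derivWithin_of_eqOn (uniqueDiffOn_Icc (hℓ e)) (hin e) (hright e)
        (hasDerivAt_edgeWave _ _ _ _ _), edgeWave_right]
      simp
      ring
    · simp only [boundaryDerivs, Sum.elim_inr]
      rw [derivWithin_of_eqOn (uniqueDiffOn_Ici 0) (hout j) self_mem_Ici
        ((hasDerivAt_exp_I_mul k 0).const_mul (b j))]
      simp [mul_comm]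
  rw [h1, h2]

theorem nonzero_graphWave {ℓ : E → ℝ} (hℓ : ∀ e, 0 < ℓ e) {k : ℂ} (hk : k ≠ 0)
    {v : E × Bool → ℂ} (hv : v ≠ 0) (b : X → ℂ) : Nonzero ℓ (graphWave ℓ k v b) := by
  by_contra hcon
  simp only [Nonzero] at hcon
  push Not at hcon
  refine hv (funext fun p => ?_)
  obtain ⟨e, i⟩ := p
  have h1 := edgeWave_eq_zero hk (hℓ e) (hcon (Sum.inl e))
  cases i
  · exact h1.1
  · exact h1.2

theorem isResonance_of_mulVec_eq (G : QuantumGraph V E X) {ℓ : E → ℝ} (hℓ : ∀ e, 0 < ℓ e) {k : ℂ}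
    (hk : 0 < k.re) {v : E × Bool → ℂ} (hv0 : v ≠ 0)
    (hv : (G.scattering k * phases ℓ k).mulVec v = v) : G.IsResonance ℓ k := by
  obtain ⟨b, hb⟩ := (G.scattering_mulVec_eq_iff ℓ hk v v).mp hv
  refine ⟨graphWave ℓ k v b, ⟨_, fun e => ⟨hasSecondSobolevDeriv_edgeWave (hℓ e) k _ _,
    Eventually.of_forall fun x => neg_neg _⟩⟩, fun j => ⟨b j, fun x _ => rfl⟩,
    (G.coupling_iff_of_eqOn hℓ k v b fun _ _ _ => rfl).mpr hb,
    nonzero_graphWave hℓ (fun h => by simp [h] at hk) hv0 b⟩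

/-- For real κ the phases have modulus one, so the incoming and outgoing amplitudes have the same
total square and the flux identity leaves only κ Σ|b|² = 0. -/
theorem AmplitudeCoupling.lead_eq_zero {G : QuantumGraph V E X} {ℓ : E → ℝ} {κ : ℝ}
    (hκ : 0 < κ) {v : E × Bool → ℂ} {b : X → ℂ}
    (h : G.AmplitudeCoupling κ (incoming ℓ κ v) v b) : b = 0 := by
  have h1 := h.flux
  have h2 : ∑ p, ‖incoming ℓ κ v p‖ ^ 2 = ∑ p, ‖v p‖ ^ 2 := by
    refine Fintype.sum_equiv (Function.Involutive.toPerm rev rev_rev) _ _ fun p => ?_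
    change _ = ‖v (rev p)‖ ^ 2
    rw [incoming, norm_mul, Complex.norm_exp]
    simp
  rw [h2] at h1
  simp only [Complex.ofReal_re, Complex.ofReal_im, sub_self, mul_zero, zero_add, zero_mul,
    mul_eq_zero, hκ.ne', false_or] at h1
  funext x
  simpa using (Finset.sum_eq_zero_iff_of_nonneg fun x _ => sq_nonneg _).mp h1 x (Finset.mem_univ x)

theorem isEigenfunction_of_mulVec_eq (G : QuantumGraph V E X) {ℓ : E → ℝ} (hℓ : ∀ e, 0 < ℓ e)
    {κ : ℝ} (hκ : 0 < κ) {v : E × Bool → ℂ} (hv0 : v ≠ 0)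
    (hv : (G.scattering κ * phases ℓ κ).mulVec v = v) :
    G.IsEigenfunction ℓ ((κ ^ 2 : ℝ) : ℂ) (graphWave ℓ κ v 0) := by
  obtain ⟨b, hb⟩ := (G.scattering_mulVec_eq_iff ℓ (by simpa using hκ) v v).mp hv
  obtain rfl := hb.lead_eq_zero hκ
  refine ⟨fun e x => -((κ : ℂ) ^ 2 * graphWave ℓ κ v 0 e x), ⟨?_,
    (G.coupling_iff_of_eqOn hℓ κ v 0 fun _ _ _ => rfl).mpr hb⟩,
    fun e => Eventually.of_forall fun x => by push_cast; exact neg_neg _,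
    nonzero_graphWave hℓ (by exact_mod_cast hκ.ne') hv0 0⟩
  rintro (e | j)
  · exact hasSecondSobolevDeriv_edgeWave (hℓ e) κ _ _
  · have h1 : graphWave ℓ κ v (0 : X → ℂ) (Sum.inr j) = fun _ => 0 := by
      funext x
      simp [graphWave]
    simp only [h1, mul_zero, neg_zero]
    exact hasSecondSobolevDeriv_zero _

theorem exists_mulVec_eq_of_isEigenvalue (G : QuantumGraph V E X) {ℓ : E → ℝ}
    (hℓ : ∀ e, 0 < ℓ e) {κ : ℝ} (hκ : 0 < κ) (h : G.IsEigenvalue ℓ ((κ ^ 2 : ℝ) : ℂ)) :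
    ∃ v ≠ 0, (G.scattering κ * phases ℓ κ).mulVec v = v := by
  obtain ⟨ψ, χ, ⟨hsob, hcoup⟩, hode, hne⟩ := h
  push_cast at hode
  have h1 : ∀ e, ∃ α β, ∀ x ∈ Icc 0 (ℓ e), ψ (Sum.inl e) x = edgeWave κ (ℓ e) α β x := fun e =>
    HasSecondSobolevDeriv.exists_eq_edgeWave (hℓ e) (by exact_mod_cast hκ.ne') (hsob (Sum.inl e))
      (hode (Sum.inl e))
  choose α β hαβ using h1
  have h2 : ∀ j, ∀ x ∈ Ici (0 : ℝ), ψ (Sum.inr j) x = 0 := fun j =>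
    HasSecondSobolevDeriv.eq_zero_on_lead hκ.ne' (hsob (Sum.inr j)) (hode (Sum.inr j))
  set v : E × Bool → ℂ := fun p => if p.2 then β p.1 else α p.1 with hv
  have h3 : ∀ e, ∀ x ∈ edgeDomain ℓ e, ψ e x = graphWave ℓ κ v (0 : X → ℂ) e x := by
    rintro (e | j) x hx
    · exact hαβ e x hx
    · rw [h2 j x hx]
      simp [graphWave]
  refine ⟨v, fun h0 => ?_, (G.scattering_mulVec_eq_iff ℓ (by simpa using hκ) v v).mpr
    ⟨0, (G.coupling_iff_of_eqOn hℓ κ v 0 h3).mp hcoup⟩⟩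
  obtain ⟨e, x, hx, hne⟩ := hne
  refine hne ?_
  rw [h3 e x hx, h0]
  rcases e with e | j <;> simp [graphWave, edgeWave]

theorem resonanceFunction_eq_zero_iff (G : QuantumGraph V E X) (ℓ : E → ℝ) (k : ℂ) :
    G.resonanceFunction ℓ k = 0 ↔ ∃ v ≠ 0, (G.scattering k * phases ℓ k).mulVec v = v := by
  rw [resonanceFunction_eq_det, ← Matrix.exists_mulVec_eq_zero_iff]
  simp only [Matrix.sub_mulVec, Matrix.one_mulVec, sub_eq_zero]
  exact exists_congr fun v => and_congr_right fun _ => eq_comm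

theorem resonanceFunction_eq_zero_of_isEigenvalue (G : QuantumGraph V E X) {ℓ : E → ℝ}
    (hℓ : ∀ e, 0 < ℓ e) {κ : ℝ} (hκ : 0 < κ) (h : G.IsEigenvalue ℓ ((κ ^ 2 : ℝ) : ℂ)) :
    G.resonanceFunction ℓ κ = 0 :=
  (G.resonanceFunction_eq_zero_iff ℓ κ).mpr (G.exists_mulVec_eq_of_isEigenvalue hℓ hκ h)

/-- In the right half-plane, the solutions of the resonance condition are embedded eigenvalues or
resonances in the lower half-plane. -/
theorem embeddedEigenvalueOrResonance_of_resonanceFunction_eq_zero [Nonempty X]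
    (G : QuantumGraph V E X) {ℓ : E → ℝ} (hℓ : ∀ e, 0 < ℓ e) {k : ℂ} (hk : 0 < k.re)
    (h : G.resonanceFunction ℓ k = 0) : G.EmbeddedEigenvalueOrResonance ℓ k := by
  obtain ⟨v, hv0, hv⟩ := (G.resonanceFunction_eq_zero_iff ℓ k).mp h
  rcases lt_trichotomy k.im 0 with him | him | him
  · exact Or.inr ⟨him, G.isResonance_of_mulVec_eq hℓ hk hv0 hv⟩
  · have hkr : k = (k.re : ℂ) := Complex.ext rfl (by simpa using him)
    rw [hkr] at hv
    exact Or.inl ⟨k.re, hk, hkr, ‹_›, by positivity,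
      _, G.isEigenfunction_of_mulVec_eq hℓ hk hv0 hv⟩
  · exact absurd (G.eq_zero_of_mulVec_eq_of_im_pos hℓ hk him hv) hv0

theorem EmbeddedEigenvalueOrResonance.im_nonpos {G : QuantumGraph V E X} {ℓ : E → ℝ} {k : ℂ}
    (h : G.EmbeddedEigenvalueOrResonance ℓ k) : k.im ≤ 0 := by
  rcases h with ⟨κ, -, rfl, -⟩ | ⟨h, -⟩
  · simp
  · exact h.le

/-- With zero lead amplitudes, the passage from amplitudes to waves is linear and injective, so
proportional eigenfunctions have proportional amplitudes. Simplicity thus becomes the kernel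
hypothesis of `deriv_det_ne_zero_of_resolvent_bound`. -/
theorem IsSimpleAt.exists_smul_eq {G : QuantumGraph V E X} {ℓ : E → ℝ} (hℓ : ∀ e, 0 < ℓ e)
    {κ : ℝ} (hκ : 0 < κ) (h : G.IsSimpleAt ℓ ((κ ^ 2 : ℝ) : ℂ)) {u v : E × Bool → ℂ} (hu0 : u ≠ 0)
    (hu : (G.scattering κ * phases ℓ κ).mulVec u = u)
    (hv : (G.scattering κ * phases ℓ κ).mulVec v = v) : ∃ c : ℂ, v = c • u := by
  by_cases hv0 : v = 0
  · exact ⟨0, by simp [hv0]⟩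
  obtain ⟨c, hc⟩ := h _ _ (G.isEigenfunction_of_mulVec_eq hℓ hκ hu0 hu)
    (G.isEigenfunction_of_mulVec_eq hℓ hκ hv0 hv)
  refine ⟨c, ?_⟩
  by_contra hne
  obtain ⟨e, x, hx, hex⟩ := nonzero_graphWave hℓ (k := κ) (by exact_mod_cast hκ.ne')
    (sub_ne_zero.mpr hne) (0 : X → ℂ)
  refine hex ?_
  have h1 := hc e x hx
  rcases e with e | j
  · simp only [graphWave, Sum.elim_inl, edgeWave, Pi.sub_apply, Pi.smul_apply, smul_eq_mul] at h1 ⊢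
    linear_combination h1
  · simp [graphWave]

/-- A simple embedded eigenvalue is a simple zero of the resonance function. -/
theorem IsSimpleAt.deriv_resonanceFunction_ne_zero {G : QuantumGraph V E X} {ℓ : E → ℝ}
    (hℓ : ∀ e, 0 < ℓ e) {κ : ℝ} (hκ : 0 < κ) (hev : G.IsEigenvalue ℓ ((κ ^ 2 : ℝ) : ℂ))
    (h : G.IsSimpleAt ℓ ((κ ^ 2 : ℝ) : ℂ)) : deriv (G.resonanceFunction ℓ) κ ≠ 0 := by
  have hF : G.resonanceFunction ℓ = fun k => (1 - G.scattering k * phases ℓ k).det :=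
    funext fun k => G.resonanceFunction_eq_det ℓ k
  obtain ⟨u, hu0, hu⟩ := G.exists_mulVec_eq_of_isEigenvalue hℓ hκ hev
  obtain ⟨C, hC⟩ := G.exists_resolvent_bound hℓ hκ
  rw [hF]
  refine deriv_det_ne_zero_of_resolvent_bound (N := fun k => 1 - G.scattering k * phases ℓ k)
    (C := C) (u₀ := u) ?_ ?_ (fun v hv => ?_) hC
  · refine (AnalyticEntries.const _ _).sub ((G.analyticEntries_scattering (by simpa)).mul ?_)
    intro i j
    simp only [phases, Matrix.diagonal_apply]
    split_ifs
    · fun_prop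
    · exact analyticAt_const
  · have := G.resonanceFunction_eq_zero_of_isEigenvalue hℓ hκ hev
    rwa [hF] at this
  · rw [Matrix.sub_mulVec, Matrix.one_mulVec, sub_eq_zero] at hv
    exact h.exists_smul_eq hℓ hκ hu0 hu hv.symm

end QuantumGraph

/-! ### Calculus for C² curves -/

section SecondDerivatives

variable {F : Type*} [NormedAddCommGroup F] [NormedSpace ℝ F]

theorem ContDiffAt.hasDerivAt_of_two {f : ℝ → F} {t : ℝ} (hf : ContDiffAt ℝ 2 f t) :
    HasDerivAt f (deriv f t) t :=
  (hf.differentiableAt (by norm_num)).hasDerivAt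

theorem ContDiffAt.hasDerivAt_deriv_of_two {f : ℝ → F} {t : ℝ} (hf : ContDiffAt ℝ 2 f t) :
    HasDerivAt (deriv f) (iteratedDeriv 2 f t) t := by
  have h1 : ContDiffAt ℝ 1 (fderiv ℝ f) t := hf.fderiv_right (by norm_num)
  have h2 : DifferentiableAt ℝ (deriv f) t := by
    have h3 : deriv f = fun s => fderiv ℝ f s 1 := funext fun s => (fderiv_apply_one_eq_deriv).symm
    rw [h3]
    exact (h1.differentiableAt (by norm_num)).clm_apply (differentiableAt_const _)
  rw [iteratedDeriv_succ, iteratedDeriv_one]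
  exact h2.hasDerivAt

theorem ContDiffOn.isLittleO_sub_taylor_two {f : ℝ → F} {δ : ℝ} (hδ : 0 < δ)
    (hf : ContDiffOn ℝ 2 f (Ioo (-δ) δ)) :
    (fun t : ℝ => f t - (f 0 + t • deriv f 0 + (t ^ 2 / 2) • iteratedDeriv 2 f 0))
      =o[𝓝 0] (fun t : ℝ => t ^ 2) := by
  have h0 : (0 : ℝ) ∈ Ioo (-δ) δ := ⟨by linarith, hδ⟩
  have h1 := taylor_isLittleO (n := 2) (convex_Ioo (-δ) δ) h0 (by exact_mod_cast hf)
  rw [isOpen_Ioo.nhdsWithin_eq h0] at h1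
  refine h1.congr (fun t => ?_) (fun t => by rw [sub_zero])
  have e1 : iteratedDerivWithin 1 f (Ioo (-δ) δ) 0 = deriv f 0 := by
    rw [iteratedDerivWithin_of_isOpen isOpen_Ioo h0, iteratedDeriv_one]
  have e2 : iteratedDerivWithin 2 f (Ioo (-δ) δ) 0 = iteratedDeriv 2 f 0 :=
    iteratedDerivWithin_of_isOpen isOpen_Ioo h0
  rw [taylorWithinEval_succ, taylorWithinEval_succ, taylor_within_zero_eval, e1, e2]
  norm_num
  ring_nf

/-- The imaginary part has a local maximum at `t`. -/
theorem im_deriv_eq_zero_of_im_nonpos {k : ℝ → ℂ} {t : ℝ} (hk : DifferentiableAt ℝ k t)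
    (h0 : (k t).im = 0) (h : ∀ᶠ s in 𝓝 t, (k s).im ≤ 0) : (deriv k t).im = 0 := by
  have h1 : HasDerivAt (fun s => (k s).im) (deriv k t).im t :=
    Complex.imCLM.hasFDerivAt.comp_hasDerivAt t hk.hasDerivAt
  refine IsLocalMax.hasDerivAt_eq_zero (f := fun s => (k s).im) ?_ h1
  filter_upwards [h] with s hs
  rwa [h0]

end SecondDerivatives

/-! ### Differentiating the resonance condition along a curve -/

namespace QuantumGraph

variable {V E X : Type*} [Fintype E] [Fintype X] [DecidableEq V] [DecidableEq E] [DecidableEq X]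

theorem contDiffAt_length {G : QuantumGraph V E X} (P : G.PseudoOrbit) {ℓ : ℝ → E → ℝ} {t : ℝ}
    (hℓ : ∀ e, ContDiffAt ℝ 2 (fun t => ℓ t e) t) :
    ContDiffAt ℝ 2 (fun t => P.length (ℓ t)) t := by
  have h1 : ∀ s : Multiset (E × Bool),
      ContDiffAt ℝ 2 (fun t => (s.map fun b => ℓ t b.1).sum) t := by
    intro s
    induction s using Multiset.induction with
    | empty => simpa using contDiffAt_const
    | cons b s ih =>
      simp only [Multiset.map_cons, Multiset.sum_cons]
      exact (hℓ _).add ih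
  unfold PseudoOrbit.length
  induction P.1 using Multiset.induction with
  | empty => simpa using contDiffAt_const
  | cons γ P ih =>
    simp only [Multiset.map_cons, Multiset.sum_cons]
    exact (h1 _).add ih

/-- The resonance function as a function of the parameter and of `k` is `C²`. -/
theorem contDiffAt_resonanceFunction (G : QuantumGraph V E X) {ℓ : ℝ → E → ℝ} {t : ℝ}
    (hℓ : ∀ e, ContDiffAt ℝ 2 (fun t => ℓ t e) t) {z : ℂ} (hz : 0 < z.re) :
    ContDiffAt ℝ 2 (fun p : ℝ × ℂ => G.resonanceFunction (ℓ p.1) p.2) (t, z) := by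
  unfold resonanceFunction
  refine ContDiffAt.sum fun P _ => ?_
  have hA : ContDiffAt ℝ 2 P.amplitude z :=
    ((analyticAt_amplitude P hz).contDiffAt (n := 2)).restrict_scalars ℝ
  have h1 : ContDiffAt ℝ 2 (fun p : ℝ × ℂ => P.amplitude p.2) (t, z) :=
    ContDiffAt.comp (t, z) (g := P.amplitude) (f := Prod.snd) hA contDiffAt_snd
  have h2 : ContDiffAt ℝ 2 (fun p : ℝ × ℂ => (P.length (ℓ p.1) : ℂ)) (t, z) :=
    Complex.ofRealCLM.contDiff.contDiffAt.comp (t, z)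
      (ContDiffAt.comp (t, z) (g := fun t => P.length (ℓ t)) (f := Prod.fst)
        (contDiffAt_length P hℓ) contDiffAt_fst)
  exact (contDiffAt_const.mul h1).mul ((contDiffAt_const.mul contDiffAt_snd).mul h2).cexp

section AlongCurve

variable {G : QuantumGraph V E X} {ℓ : ℝ → E → ℝ} {k : ℝ → ℂ} {t : ℝ}

theorem hasDerivAt_phase (P : G.PseudoOrbit) (hℓ : ∀ e, ContDiffAt ℝ 2 (fun t => ℓ t e) t)
    (hk : ContDiffAt ℝ 2 k t) :
    HasDerivAt (fun s => Complex.exp (Complex.I * k s * (P.length (ℓ s) : ℂ)))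
      (Complex.exp (Complex.I * k t * (P.length (ℓ t) : ℂ)) *
        (Complex.I * (deriv k t * (P.length (ℓ t) : ℂ) + k t * (P.lengthDot ℓ t : ℂ)))) t := by
  have h1 := (hk.hasDerivAt_of_two.const_mul Complex.I).mul
    (contDiffAt_length P hℓ).hasDerivAt_of_two.ofReal_comp
  refine h1.cexp.congr_deriv ?_
  rw [PseudoOrbit.lengthDot]
  simp only [Pi.mul_apply]
  ring

theorem hasDerivAt_amplitude (P : G.PseudoOrbit) (hre : 0 < (k t).re) (hk : ContDiffAt ℝ 2 k t) :
    HasDerivAt (fun s => P.amplitude (k s)) (deriv P.amplitude (k t) * deriv k t) t :=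
  (analyticAt_amplitude P hre).differentiableAt.hasDerivAt.comp t hk.hasDerivAt_of_two

theorem hasDerivAt_deriv_amplitude (P : G.PseudoOrbit) (hre : 0 < (k t).re)
    (hk : ContDiffAt ℝ 2 k t) :
    HasDerivAt (fun s => deriv P.amplitude (k s))
      (iteratedDeriv 2 P.amplitude (k t) * deriv k t) t := by
  rw [iteratedDeriv_succ, iteratedDeriv_one]
  exact (analyticAt_amplitude P hre).deriv.differentiableAt.hasDerivAt.comp t hk.hasDerivAt_of_two

/-- The factor i comes from the phases; the derivative of an amplitude is absorbed as A' = i(-iA'),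
which explains the -i∂A/∂k in the leading coefficient. -/
theorem hasDerivAt_resonanceFunction (hℓ : ∀ e, ContDiffAt ℝ 2 (fun t => ℓ t e) t)
    (hre : 0 < (k t).re) (hk : ContDiffAt ℝ 2 k t) :
    HasDerivAt (fun s => G.resonanceFunction (ℓ s) (k s))
      (Complex.I * (deriv k t * G.leadingCoefficient (ℓ t) (k t)
        + k t * ∑ P : G.PseudoOrbit, (P.lengthDot ℓ t : ℂ) * P.sign * P.amplitude (k t)
          * Complex.exp (Complex.I * k t * (P.length (ℓ t) : ℂ)))) t := by
  unfold resonanceFunction leadingCoefficient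
  refine (HasDerivAt.fun_sum fun P _ => ((hasDerivAt_amplitude P hre hk).const_mul P.sign).mul
    (hasDerivAt_phase P hℓ hk)).congr_deriv ?_
  rw [Finset.mul_sum, Finset.mul_sum, ← Finset.sum_add_distrib, Finset.mul_sum]
  refine Finset.sum_congr rfl fun P _ => ?_
  linear_combination (deriv k t * deriv P.amplitude (k t) * P.sign *
    Complex.exp (Complex.I * k t * (P.length (ℓ t) : ℂ))) * Complex.I_sq

/-- The derivative of the leading coefficient along a curve. -/
theorem hasDerivAt_leadingCoefficient (hℓ : ∀ e, ContDiffAt ℝ 2 (fun t => ℓ t e) t)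
    (hre : 0 < (k t).re) (hk : ContDiffAt ℝ 2 k t) :
    HasDerivAt (fun s => G.leadingCoefficient (ℓ s) (k s))
      (∑ P : G.PseudoOrbit, ((P.lengthDot ℓ t : ℂ) * P.amplitude (k t)
          + 2 * (P.length (ℓ t) : ℂ) * deriv P.amplitude (k t) * deriv k t
          - Complex.I * iteratedDeriv 2 P.amplitude (k t) * deriv k t
          + Complex.I * (P.length (ℓ t) : ℂ) * P.amplitude (k t) *
            (deriv k t * (P.length (ℓ t) : ℂ) + k t * (P.lengthDot ℓ t : ℂ))
          + deriv P.amplitude (k t) * k t * (P.lengthDot ℓ t : ℂ))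
        * P.sign * Complex.exp (Complex.I * k t * (P.length (ℓ t) : ℂ))) t := by
  unfold leadingCoefficient
  refine (HasDerivAt.fun_sum fun P _ =>
    ((((contDiffAt_length P hℓ).hasDerivAt_of_two.ofReal_comp.mul
      (hasDerivAt_amplitude P hre hk)).sub
      ((hasDerivAt_deriv_amplitude P hre hk).const_mul Complex.I)).mul_const P.sign).mul
    (hasDerivAt_phase P hℓ hk)).congr_deriv ?_
  refine Finset.sum_congr rfl fun P _ => ?_
  simp only [PseudoOrbit.lengthDot, Pi.mul_apply, Pi.sub_apply]
  linear_combination (-(deriv P.amplitude (k t) * P.sign *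
    Complex.exp (Complex.I * k t * (P.length (ℓ t) : ℂ)) *
    (deriv k t * (P.length (ℓ t) : ℂ) + k t * ((deriv (fun s => P.length (ℓ s)) t : ℝ) : ℂ)))) *
    Complex.I_sq

theorem hasDerivAt_sum_lengthDot (hℓ : ∀ e, ContDiffAt ℝ 2 (fun t => ℓ t e) t)
    (hre : 0 < (k t).re) (hk : ContDiffAt ℝ 2 k t) :
    HasDerivAt (fun s => ∑ P : G.PseudoOrbit, (P.lengthDot ℓ s : ℂ) * P.sign * P.amplitude (k s)
          * Complex.exp (Complex.I * k s * (P.length (ℓ s) : ℂ)))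
      (∑ P : G.PseudoOrbit, ((P.lengthDDot ℓ t : ℂ) * P.amplitude (k t)
          + (P.lengthDot ℓ t : ℂ) * deriv P.amplitude (k t) * deriv k t
          + Complex.I * (P.lengthDot ℓ t : ℂ) * P.amplitude (k t) *
            (deriv k t * (P.length (ℓ t) : ℂ) + k t * (P.lengthDot ℓ t : ℂ)))
        * P.sign * Complex.exp (Complex.I * k t * (P.length (ℓ t) : ℂ))) t := by
  refine (HasDerivAt.fun_sum fun P _ =>
    (((contDiffAt_length P hℓ).hasDerivAt_deriv_of_two.ofReal_comp.mul_const P.sign).mul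
      (hasDerivAt_amplitude P hre hk)).mul (hasDerivAt_phase P hℓ hk)).congr_deriv ?_
  refine Finset.sum_congr rfl fun P _ => ?_
  simp only [PseudoOrbit.lengthDot, PseudoOrbit.lengthDDot, Pi.mul_apply]
  ring

theorem firstOrderEquation_of_eventually_eq_zero
    (hℓ : ∀ e, ContDiffAt ℝ 2 (fun t => ℓ t e) t) (hre : 0 < (k t).re) (hk : ContDiffAt ℝ 2 k t)
    (h : ∀ᶠ s in 𝓝 t, G.resonanceFunction (ℓ s) (k s) = 0) : G.FirstOrderEquation ℓ k t := by
  have h1 := hasDerivAt_resonanceFunction (G := G) hℓ hre hk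
  have h2 : HasDerivAt (fun s => G.resonanceFunction (ℓ s) (k s)) 0 t :=
    (hasDerivAt_const t (0 : ℂ)).congr_of_eventuallyEq h
  exact (mul_eq_zero.mp (h1.unique h2)).resolve_left Complex.I_ne_zero

theorem eventually_firstOrderEquation
    (hℓ : ∀ e, ContDiffAt ℝ 2 (fun t => ℓ t e) t) (hre : 0 < (k t).re) (hk : ContDiffAt ℝ 2 k t)
    (h : ∀ᶠ s in 𝓝 t, G.resonanceFunction (ℓ s) (k s) = 0) :
    ∀ᶠ s in 𝓝 t, G.FirstOrderEquation ℓ k s := by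
  filter_upwards [eventually_all.mpr fun e => (hℓ e).eventually (by simp),
    hk.eventually (by simp), h.eventually_nhds,
    (Complex.continuous_re.continuousAt.comp hk.continuousAt).eventually (lt_mem_nhds hre)]
    with s h1 h2 h3 h4
  exact firstOrderEquation_of_eventually_eq_zero h1 h4 h2 h3

/-- The first-order equation holds at all nearby parameters, so it can be differentiated by the
product rule; the result is regrouped by powers of the derivatives of `k`. -/
theorem secondOrderEquation_of_eventually_eq_zero
    (hℓ : ∀ e, ContDiffAt ℝ 2 (fun t => ℓ t e) t) (hre : 0 < (k t).re) (hk : ContDiffAt ℝ 2 k t)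
    (h : ∀ᶠ s in 𝓝 t, G.resonanceFunction (ℓ s) (k s) = 0) : G.SecondOrderEquation ℓ k t := by
  have h1 := (hk.hasDerivAt_deriv_of_two.mul (hasDerivAt_leadingCoefficient (G := G) hℓ hre hk)).add
    (hk.hasDerivAt_of_two.mul (hasDerivAt_sum_lengthDot (G := G) hℓ hre hk))
  have h2 := h1.unique ((hasDerivAt_const t (0 : ℂ)).congr_of_eventuallyEq
    (eventually_firstOrderEquation hℓ hre hk h))
  rw [SecondOrderEquation, ← h2]
  simp only [add_assoc]
  congr 1
  simp only [Finset.mul_sum, ← Finset.sum_add_distrib]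
  refine Finset.sum_congr rfl fun P _ => ?_
  ring

end AlongCurve

/-- The partial derivative of the resonance function with respect to `k`. -/
theorem hasDerivAt_resonanceFunction_leadingCoefficient (G : QuantumGraph V E X) (ℓ : E → ℝ)
    {z : ℂ} (hz : 0 < z.re) :
    HasDerivAt (G.resonanceFunction ℓ) (Complex.I * G.leadingCoefficient ℓ z) z := by
  have hexp : ∀ L : ℂ, HasDerivAt (fun z => Complex.exp (Complex.I * z * L))
      (Complex.exp (Complex.I * z * L) * (Complex.I * L)) z := by
    intro L
    have h1 : HasDerivAt (fun z : ℂ => Complex.I * z * L) (Complex.I * L) z := by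
      simpa using ((hasDerivAt_id z).const_mul Complex.I).mul_const L
    exact h1.cexp
  unfold resonanceFunction leadingCoefficient
  refine (HasDerivAt.fun_sum fun P _ =>
    (((analyticAt_amplitude P hz).differentiableAt.hasDerivAt).const_mul P.sign).mul
      (hexp (P.length ℓ))).congr_deriv ?_
  rw [Finset.mul_sum]
  refine Finset.sum_congr rfl fun P _ => ?_
  linear_combination (deriv P.amplitude z * P.sign *
    Complex.exp (Complex.I * z * (P.length ℓ : ℂ))) * Complex.I_sq

/-- The parameter is real, so the implicit function theorem is used over ℝ. The partial derivative
in k is multiplication by a nonzero complex number, which is invertible as a real-linear map of ℂ.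
-/
theorem isInvertible_fderiv_resonanceFunction (G : QuantumGraph V E X) {ℓ : ℝ → E → ℝ} {t : ℝ}
    (hℓ : ∀ e, ContDiffAt ℝ 2 (fun t => ℓ t e) t) {z : ℂ} (hz : 0 < z.re)
    (hne : G.leadingCoefficient (ℓ t) z ≠ 0) :
    (fderiv ℝ (fun p : ℝ × ℂ => G.resonanceFunction (ℓ p.1) p.2) (t, z) ∘L
      .inr ℝ ℝ ℂ).IsInvertible := by
  have h1 := ((G.contDiffAt_resonanceFunction hℓ hz).differentiableAt (by norm_num)).hasFDerivAt
  have h2 : HasFDerivAt (fun w : ℂ => (t, w)) (ContinuousLinearMap.inr ℝ ℝ ℂ) z :=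
    hasFDerivAt_prodMk_right t z
  have h3 := HasFDerivAt.comp z h1 h2
  have h4 := (G.hasDerivAt_resonanceFunction_leadingCoefficient (ℓ t)
    hz).hasFDerivAt.restrictScalars ℝ
  rw [h3.unique h4]
  have hc : Complex.I * G.leadingCoefficient (ℓ t) z ≠ 0 := mul_ne_zero Complex.I_ne_zero hne
  generalize Complex.I * G.leadingCoefficient (ℓ t) z = c at hc ⊢
  refine ContinuousLinearMap.IsInvertible.of_inverse
    (g := (ContinuousLinearMap.toSpanSingleton ℂ c⁻¹).restrictScalars ℝ) ?_ ?_
  · ext w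
    simp [hc]
  · ext w
    simp [hc]

end QuantumGraph

/-! ### The theorem, by the implicit function theorem -/

theorem mainTheorem1 {V E X : Type*} [Fintype E] [Fintype X]
    [DecidableEq V] [DecidableEq E] [DecidableEq X]
    (G : QuantumGraph V E X) (ℓ : ℝ → E → ℝ)
    (hpos : ∀ e, 0 < ℓ 0 e) (hsmooth : ∀ e, ContDiffAt ℝ 2 (fun t => ℓ t e) 0)
    (k₀ : ℝ) (hk₀ : 0 < k₀) (hev : G.IsEmbeddedEigenvalue (ℓ 0) (k₀ ^ 2)) :
    -- if the eigenvalue is simple, then for small `t` there is a unique solution near `k₀`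
    (G.IsSimpleAt (ℓ 0) ((k₀ ^ 2 : ℝ) : ℂ) →
      ∃ δ > 0, ∃ ε > 0, ∃ k : ℝ → ℂ,
        k 0 = k₀ ∧ ContDiffOn ℝ 2 k (Set.Ioo (-δ) δ) ∧
        (deriv k 0).im = 0 ∧
        (∀ t ∈ Set.Ioo (-δ) δ,
          (∀ e, 0 < ℓ t e) ∧
          (∀ z : ℂ, (z ∈ Metric.ball (k₀ : ℂ) ε ∧ G.resonanceFunction (ℓ t) z = 0) ↔ z = k t) ∧
          G.EmbeddedEigenvalueOrResonance (ℓ t) (k t) ∧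
          (∀ P : G.PseudoOrbit, AnalyticAt ℂ P.amplitude (k t)) ∧
          G.leadingCoefficient (ℓ t) (k t) ≠ 0 ∧
          G.FirstOrderEquation ℓ k t ∧ G.SecondOrderEquation ℓ k t) ∧
        (fun t : ℝ => k t - (k₀ + (t : ℂ) * deriv k 0 + (t : ℂ) ^ 2 / 2 * iteratedDeriv 2 k 0))
          =o[𝓝 0] (fun t : ℝ => t ^ 2)) ∧
    -- whatever the multiplicity, solutions near `k₀` are embedded eigenvalues or resonances
    (∃ δ > 0, ∃ ε > 0, ∀ t ∈ Set.Ioo (-δ) δ, ∀ z ∈ Metric.ball (k₀ : ℂ) ε,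
      G.resonanceFunction (ℓ t) z = 0 → G.EmbeddedEigenvalueOrResonance (ℓ t) z) ∧
    -- and the assertions on the derivatives hold along every `C²` branch of solutions
    (∀ k : ℝ → ℂ, k 0 = k₀ → ContDiffAt ℝ 2 k 0 →
      (∀ᶠ t in 𝓝 (0 : ℝ), G.resonanceFunction (ℓ t) (k t) = 0) →
      (deriv k 0).im = 0 ∧
      (∀ᶠ t in 𝓝 (0 : ℝ), (∀ P : G.PseudoOrbit, AnalyticAt ℂ P.amplitude (k t)) ∧
        G.FirstOrderEquation ℓ k t ∧ G.SecondOrderEquation ℓ k t)) := by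
  obtain ⟨hX, -, heig⟩ := hev
  have hposev : ∀ᶠ t in 𝓝 (0 : ℝ), ∀ e, 0 < ℓ t e :=
    eventually_all.mpr fun e => (hsmooth e).continuousAt.eventually (lt_mem_nhds (hpos e))
  have hsmoothev : ∀ᶠ t in 𝓝 (0 : ℝ), ∀ e, ContDiffAt ℝ 2 (fun t => ℓ t e) t :=
    eventually_all.mpr fun e => (hsmooth e).eventually (by simp)
  have hreev : ∀ k : ℝ → ℂ, k 0 = k₀ → ContDiffAt ℝ 2 k 0 → ∀ᶠ t in 𝓝 (0 : ℝ), 0 < (k t).re := by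
    intro k h0 hk
    exact (Complex.continuous_re.continuousAt.comp hk.continuousAt).eventually
      (lt_mem_nhds (by simpa [h0] using hk₀))
  have himev : ∀ k : ℝ → ℂ, k 0 = k₀ → ContDiffAt ℝ 2 k 0 →
      (∀ᶠ t in 𝓝 (0 : ℝ), G.resonanceFunction (ℓ t) (k t) = 0) → (deriv k 0).im = 0 := by
    intro k h0 hk hF
    refine im_deriv_eq_zero_of_im_nonpos (hk.differentiableAt (by norm_num)) (by simp [h0]) ?_
    filter_upwards [hF, hreev k h0 hk, hposev] with t h1 h2 h3
    exact (G.embeddedEigenvalueOrResonance_of_resonanceFunction_eq_zero h3 h2 h1).im_nonpos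
  refine ⟨fun hsimple => ?_, ?_, fun k h0 hk hF => ⟨himev k h0 hk hF, ?_⟩⟩
  · have hk₀' : 0 < (k₀ : ℂ).re := hk₀
    have hF0 : G.resonanceFunction (ℓ 0) k₀ = 0 :=
      G.resonanceFunction_eq_zero_of_isEigenvalue hpos hk₀ heig
    have hlead : G.leadingCoefficient (ℓ 0) k₀ ≠ 0 := by
      have h1 := hsimple.deriv_resonanceFunction_ne_zero hpos hk₀ heig
      rw [(G.hasDerivAt_resonanceFunction_leadingCoefficient (ℓ 0) hk₀').deriv] at h1
      exact right_ne_zero_of_mul h1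
    have cdf := G.contDiffAt_resonanceFunction hsmooth hk₀'
    have hinv := G.isInvertible_fderiv_resonanceFunction hsmooth hk₀' hlead
    set k := cdf.implicitFunction (by norm_num) hinv
    have hk0 : k 0 = k₀ := cdf.implicitFunction_apply_self (by norm_num) hinv
    have hk : ContDiffAt ℝ 2 k 0 := cdf.contDiffAt_implicitFunction (by norm_num) hinv
    have hiff := cdf.eventually_apply_eq_iff_implicitFunction (by norm_num) hinv
    -- A product neighbourhood is needed so that one ε serves for all small `t`; then δ is shrunk
    -- until k(t) stays in the ε-ball.
    rw [nhds_prod_eq, (Metric.nhds_basis_ball.prod Metric.nhds_basis_ball).eventually_iff] at hiff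
    obtain ⟨⟨δ₁, ε⟩, ⟨hδ₁, hε⟩, hiff⟩ := hiff
    have hiff' : ∀ t ∈ Metric.ball (0 : ℝ) δ₁, ∀ z ∈ Metric.ball (k₀ : ℂ) ε,
        (G.resonanceFunction (ℓ t) z = 0 ↔ k t = z) := by
      intro t ht z hz
      have h1 := hiff (x := (t, z)) ⟨ht, hz⟩
      simp only [hF0] at h1
      exact h1
    have hball : ∀ᶠ t in 𝓝 (0 : ℝ), k t ∈ Metric.ball (k₀ : ℂ) ε :=
      hk.continuousAt.eventually (by rw [hk0]; exact Metric.ball_mem_nhds _ hε)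
    -- The leading coefficient is continuous along the branch because it is differentiable there.
    have hleadev : ∀ᶠ t in 𝓝 (0 : ℝ), G.leadingCoefficient (ℓ t) (k t) ≠ 0 :=
      (QuantumGraph.hasDerivAt_leadingCoefficient hsmooth (by rw [hk0]; exact hk₀')
        hk).continuousAt.eventually_ne (by rwa [hk0])
    obtain ⟨δ, hδ, hall⟩ := Metric.eventually_nhds_iff_ball.mp (hposev.and (hsmoothev.and
      ((hreev k hk0 hk).and ((hk.eventually (by simp)).and (hball.and (hleadev.and
        (Metric.ball_mem_nhds (0 : ℝ) hδ₁)))))))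
    have hIoo : Metric.ball (0 : ℝ) δ = Ioo (-δ) δ := by
      rw [Real.ball_eq_Ioo, zero_sub, zero_add]
    rw [hIoo] at hall
    have hzero : ∀ t ∈ Ioo (-δ) δ, G.resonanceFunction (ℓ t) (k t) = 0 := fun t ht => by
      obtain ⟨-, -, -, -, h5, -, h7⟩ := hall t ht
      exact (hiff' t h7 _ h5).mpr rfl
    have hon : ContDiffOn ℝ 2 k (Ioo (-δ) δ) := fun t ht =>
      (hall t ht).2.2.2.1.contDiffWithinAt
    refine ⟨δ, hδ, ε, hε, k, hk0, hon,
      himev k hk0 hk (eventually_of_mem (Ioo_mem_nhds (by linarith) hδ) hzero), ?_, ?_⟩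
    · intro t ht
      obtain ⟨h1, h2, h3, h4, h5, h6, h7⟩ := hall t ht
      have h8 : ∀ᶠ s in 𝓝 t, G.resonanceFunction (ℓ s) (k s) = 0 :=
        eventually_of_mem (isOpen_Ioo.mem_nhds ht) hzero
      refine ⟨h1, fun z => ⟨fun hz => ((hiff' t h7 z hz.1).mp hz.2).symm, ?_⟩,
        G.embeddedEigenvalueOrResonance_of_resonanceFunction_eq_zero h1 h3 (hzero t ht),
        fun P => QuantumGraph.analyticAt_amplitude P h3, h6,
        QuantumGraph.firstOrderEquation_of_eventually_eq_zero h2 h3 h4 h8,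
        QuantumGraph.secondOrderEquation_of_eventually_eq_zero h2 h3 h4 h8⟩
      rintro rfl
      exact ⟨h5, hzero t ht⟩
    · refine (hon.isLittleO_sub_taylor_two hδ).congr_left fun t => ?_
      simp [hk0, Complex.real_smul]
  · obtain ⟨δ, hδ, hδpos⟩ := Metric.eventually_nhds_iff_ball.mp hposev
    rw [Real.ball_eq_Ioo, zero_sub, zero_add] at hδpos
    -- The radius k₀ keeps the ball inside the right half-plane, which is all that the alternative
    -- requires.
    refine ⟨δ, hδ, k₀, hk₀, fun t ht z hz hF => ?_⟩
    refine G.embeddedEigenvalueOrResonance_of_resonanceFunction_eq_zero (hδpos t ht) ?_ hF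
    have h1 := (Complex.abs_re_le_norm (z - k₀)).trans_lt (mem_ball_iff_norm.mp hz)
    have h2 := (abs_lt.mp h1).1
    simp only [Complex.sub_re, Complex.ofReal_re] at h2
    linarith
  · filter_upwards [hF.eventually_nhds, hreev k h0 hk, hsmoothev, hk.eventually (by simp)]
      with t h1 h2 h3 h4
    exact ⟨fun P => QuantumGraph.analyticAt_amplitude P h2,
      QuantumGraph.firstOrderEquation_of_eventually_eq_zero h3 h2 h4 h1,
      QuantumGraph.secondOrderEquation_of_eventually_eq_zero h3 h2 h4 h1⟩
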